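/- Let $\mathcal H$ be a complex Hilbert space and let $H_s, W_s, \rho_s(0)$ be bounded linear operators on $\mathcal H$, with $H_s$ and $W_s$ self-adjoint; $\|\cdot\|$ is the operator norm. Let $B:\mathbb R^2\to\mathbb C$ satisfy $|B(\tau_1,\tau_2)|\le \bar B$ for all $\tau_1,\tau_2$, and suppose that at all points with $\tau_1\ne0$, $\tau_2\neq 0$ the partial derivatives of $B$ of first and second order exist, with $|\partial_{\tau_1}B|+|\partial_{\tau_2}B|\le \bar B'$ and with each of the four second-order partial derivatives bounded in absolute value by $\bar B''$. For real numbers $\tau_1\le\dots\le\tau_N$ put $$\mathcal L_b(\tau_1,\dots,\tau_N)=\sum_{\mathfrak q}\ \prod_{\{i<j\}\in\mathfrak q}B(\tau_i,\tau_j),$$ the sum being over all partitions $\mathfrak q$ of $\{1,\dots,N\}$ into pairs (so $\mathcal L_b=1$ for $N=0$ and $\mathcal L_b=0$ for odd $N$). For $t\ge 0$ let $$\rho_s(t)=\sum_{m,m'=0}^{\infty}(-\mathrm i)^m\,\mathrm i^{m'}\int_{0<t_1<\dots<t_m<t}\int_{0<t_1'<\dots<t'_{m'}<t}e^{-\mathrm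 iH_s(t-t_m)}W_s\cdots W_se^{-\mathrm iH_st_1}\,\rho_s(0)\,e^{\mathrm iH_st_1'}W_s\cdots W_se^{\mathrm iH_s(t-t'_{m'})}\ \mathcal L_b(-t_m,\dots,-t_1,t_1',\dots,t'_{m'})\,\mathrm dt'\,\mathrm dt .$$ For a time step $\Delta t>0$ let $$\mathcal P_0=e^{-\mathrm iH_s\Delta t},\quad \mathcal P_1=-\mathrm i\,\Delta t\,e^{-\mathrm iH_s\Delta t/2}W_se^{-\mathrm iH_s\Delta t/2},\quad \mathcal P_2=-\tfrac{\Delta t^2}{2}e^{-\mathrm iH_s\Delta t/2}W_s^2e^{-\mathrm iH_s\Delta t/2},$$ and define the second-order scheme $$\rho_{s,n}=\sum_{j_{1-},\dots,j_{n-},\,j_{1+},\dots,j_{n+}\in\{0,1,2\}}\mathcal P_{j_{n-}}\cdots\mathcal P_{j_{1-}}\,\rho_s(0)\,\mathcal P_{j_{1+}}^\dagger\cdots\mathcal P_{j_{n+}}^\dagger\ \mathcal L_b(\boldsymbol\tau_{\boldsymbol j}),$$ where $\boldsymbol\tau_{\boldsymbol j}$ is the increasing list in which each $-(k-\tfrac12)\Delta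 t$ occurs $j_{k-}$ times and each $(k-\tfrac12)\Delta t$ occurs $j_{k+}$ times, $k=1,\dots,n$. Then there is a constant $C$, depending only on $\|\rho_s(0)\|$, $\|W_s\|$, $\|H_s\|$, $\bar B$, $\bar B'$, $\bar B''$ and $T=n\Delta t$, such that all the integrals defining $\rho_s(n\Delta t)$ converge absolutely, the double series converges unconditionally in operator norm, and $$\|\rho_{s,n}-\rho_s(n\Delta t)\|\le C\,\Delta t^2 .$$ -/

import Mathlib

open MeasureTheory

noncomputable section

namespace OpenSystem

/-! ### The bath: correlation function and influence functional -/

/-- All pairings (perfect matchings) of `{0, …, N - 1}`, encoded as the involutions without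
fixed points: `i` is paired with `σ i`. -/
def pairings (N : ℕ) : Finset (Equiv.Perm (Fin N)) :=
  {σ | ∀ i, σ (σ i) = i ∧ σ i ≠ i}

/-- The bath influence functional of the ordered time points `τ 0, …, τ (N - 1)`: the sum over
all pairings of the product of `B (τ i) (τ j)` over the pairs `{i, j}`, `i < j`. It is `1` for
`N = 0` (empty pairing) and `0` for odd `N` (no pairing). -/
def bathInfluence (B : ℝ → ℝ → ℂ) {N : ℕ} (τ : Fin N → ℝ) : ℂ :=
  ∑ σ ∈ pairings N, ∏ i : Fin N with i < σ i, B (τ i) (τ (σ i))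

/-- `∂B/∂τ₁`. -/
def pderiv₁ (B : ℝ → ℝ → ℂ) (τ₁ τ₂ : ℝ) : ℂ := deriv (fun x => B x τ₂) τ₁

/-- `∂B/∂τ₂`. -/
def pderiv₂ (B : ℝ → ℝ → ℂ) (τ₁ τ₂ : ℝ) : ℂ := deriv (fun x => B τ₁ x) τ₂

/-- Both first-order partial derivatives of `B` exist at `(τ₁, τ₂)`. -/
def HasPartials (B : ℝ → ℝ → ℂ) (τ₁ τ₂ : ℝ) : Prop :=
  DifferentiableAt ℝ (fun x => B x τ₂) τ₁ ∧ DifferentiableAt ℝ (fun x => B τ₁ x) τ₂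

/-- The hypotheses on the bath correlation function: `B` is bounded by `b`; away from the axes
`τ₁ = 0` and `τ₂ = 0` its partial derivatives of first and second order exist, with
`|∂₁B| + |∂₂B| ≤ b'` and every second-order partial derivative bounded by `b''`.
The axes are left out because correlation functions of harmonic baths, which depend on
`|τ₁| - |τ₂|`, have kinks there. -/
structure BathBounds (B : ℝ → ℝ → ℂ) (b b' b'' : ℝ) : Prop where
  bound : ∀ τ₁ τ₂, ‖B τ₁ τ₂‖ ≤ b
  partials : ∀ τ₁ τ₂, τ₁ ≠ 0 → τ₂ ≠ 0 → HasPartials B τ₁ τ₂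
  bound' : ∀ τ₁ τ₂, τ₁ ≠ 0 → τ₂ ≠ 0 → ‖pderiv₁ B τ₁ τ₂‖ + ‖pderiv₂ B τ₁ τ₂‖ ≤ b'
  partials₁ : ∀ τ₁ τ₂, τ₁ ≠ 0 → τ₂ ≠ 0 → HasPartials (pderiv₁ B) τ₁ τ₂
  partials₂ : ∀ τ₁ τ₂, τ₁ ≠ 0 → τ₂ ≠ 0 → HasPartials (pderiv₂ B) τ₁ τ₂
  bound₁₁ : ∀ τ₁ τ₂, τ₁ ≠ 0 → τ₂ ≠ 0 → ‖pderiv₁ (pderiv₁ B) τ₁ τ₂‖ ≤ b''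
  bound₂₁ : ∀ τ₁ τ₂, τ₁ ≠ 0 → τ₂ ≠ 0 → ‖pderiv₂ (pderiv₁ B) τ₁ τ₂‖ ≤ b''
  bound₁₂ : ∀ τ₁ τ₂, τ₁ ≠ 0 → τ₂ ≠ 0 → ‖pderiv₁ (pderiv₂ B) τ₁ τ₂‖ ≤ b''
  bound₂₂ : ∀ τ₁ τ₂, τ₁ ≠ 0 → τ₂ ≠ 0 → ‖pderiv₂ (pderiv₂ B) τ₁ τ₂‖ ≤ b''

/-! ### The exact reduced density matrix (Dyson series) -/

section System

variable {E : Type*} [NormedAddCommGroup E] [InnerProductSpace ℂ E] [CompleteSpace E]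

/-- The free propagator `exp (-i t Hs)`. -/
def freeProp (Hs : E →L[ℂ] E) (t : ℝ) : E →L[ℂ] E :=
  NormedSpace.exp ((-Complex.I * (t : ℂ)) • Hs)

/-- `e^{-i Hs (t - t_m)} Ws e^{-i Hs (t_m - t_{m-1})} Ws ⋯ Ws e^{-i Hs t_1}`,
where `t_k = s (k - 1)`. -/
def leftDyson (Hs Ws : E →L[ℂ] E) : (m : ℕ) → (Fin m → ℝ) → ℝ → (E →L[ℂ] E)
  | 0, _, t => freeProp Hs t
  | m + 1, s, t =>
      freeProp Hs (t - s (Fin.last m)) * Ws * leftDyson Hs Ws m (Fin.init s) (s (Fin.last m))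

/-- `e^{i Hs t_1} Ws e^{i Hs (t_2 - t_1)} Ws ⋯ Ws e^{i Hs (t - t_m)}`,
where `t_k = s (k - 1)`. -/
def rightDyson (Hs Ws : E →L[ℂ] E) : (m : ℕ) → (Fin m → ℝ) → ℝ → (E →L[ℂ] E)
  | 0, _, t => freeProp Hs (-t)
  | m + 1, s, t =>
      rightDyson Hs Ws m (Fin.init s) (s (Fin.last m)) * Ws * freeProp Hs (-(t - s (Fin.last m)))

/-- The simplex `0 < t_1 < ⋯ < t_m < t`. -/
def simplex (m : ℕ) (t : ℝ) : Set (Fin m → ℝ) :=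
  {s | StrictMono s ∧ ∀ i, 0 < s i ∧ s i < t}

/-- The integrand of the `(m, m')` term of the Dyson series of the reduced density matrix, at the
point `(t_1, …, t_m; t'_1, …, t'_{m'})`. The arguments of the influence functional are
`-t_m, …, -t_1, t'_1, …, t'_{m'}`, in this order. -/
def dysonIntegrand (Hs Ws ρ₀ : E →L[ℂ] E) (B : ℝ → ℝ → ℂ) (t : ℝ) (m m' : ℕ)
    (s : (Fin m → ℝ) × (Fin m' → ℝ)) : E →L[ℂ] E :=
  ((-Complex.I) ^ m * Complex.I ^ m' *
      bathInfluence B (Fin.append (fun i => -s.1 (Fin.rev i)) s.2)) •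
    (leftDyson Hs Ws m s.1 t * ρ₀ * rightDyson Hs Ws m' s.2 t)

/-- The `(m, m')` term of the Dyson series of the reduced density matrix. -/
def dysonTerm (Hs Ws ρ₀ : E →L[ℂ] E) (B : ℝ → ℝ → ℂ) (t : ℝ) (p : ℕ × ℕ) : E →L[ℂ] E :=
  ∫ s in simplex p.1 t ×ˢ simplex p.2 t, dysonIntegrand Hs Ws ρ₀ B t p.1 p.2 s

/-- The reduced density matrix `ρ_s(t)`, the sum of its Dyson series. -/
def reducedDensity (Hs Ws ρ₀ : E →L[ℂ] E) (B : ℝ → ℝ → ℂ) (t : ℝ) : E →L[ℂ] E :=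
  ∑' p : ℕ × ℕ, dysonTerm Hs Ws ρ₀ B t p

/-! ### The second-order scheme -/

/-- The one-step operators `P_{s,0}`, `P_{s,1}`, `P_{s,2}` for the time step `δ`. -/
def stepOp (Hs Ws : E →L[ℂ] E) (δ : ℝ) : Fin 3 → (E →L[ℂ] E)
  | 0 => freeProp Hs δ
  | 1 => (-Complex.I * (δ : ℂ)) • (freeProp Hs (δ / 2) * Ws * freeProp Hs (δ / 2))
  | 2 => (-((δ : ℂ) ^ 2 / 2)) • (freeProp Hs (δ / 2) * Ws ^ 2 * freeProp Hs (δ / 2))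

/-- The time points of the discrete influence functional, in increasing order: for `k = n, …, 1`
the midpoint `-(k - 1/2) δ` repeated `j_{k-}` times, then for `k = 1, …, n` the midpoint
`(k - 1/2) δ` repeated `j_{k+}` times. Here `j_{k∓}` is `jm (k - 1)`, `jp (k - 1)`. -/
def midpoints (δ : ℝ) {n : ℕ} (jm jp : Fin n → Fin 3) : List ℝ :=
  (List.ofFn fun k : Fin n =>
      List.replicate (jm k : ℕ) (-(((k : ℕ) : ℝ) + 1 / 2) * δ)).reverse.flatten ++
    (List.ofFn fun k : Fin n =>
      List.replicate (jp k : ℕ) ((((k : ℕ) : ℝ) + 1 / 2) * δ)).flatten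

/-- The second-order scheme `ρ_{s,n}` with time step `δ`: the sum over all
`j_{1-}, …, j_{n-}, j_{1+}, …, j_{n+} ∈ {0, 1, 2}` of
`P_{j_{n-}} ⋯ P_{j_{1-}} ρ₀ P_{j_{1+}}† ⋯ P_{j_{n+}}†` times the influence functional. -/
def secondOrderScheme (Hs Ws ρ₀ : E →L[ℂ] E) (B : ℝ → ℝ → ℂ) (δ : ℝ) (n : ℕ) : E →L[ℂ] E :=
  ∑ jm : Fin n → Fin 3, ∑ jp : Fin n → Fin 3,
    bathInfluence B (midpoints δ jm jp).get •
      ((List.ofFn fun k => stepOp Hs Ws δ (jm k)).reverse.prod * ρ₀ *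
        (List.ofFn fun k => star (stepOp Hs Ws δ (jp k))).prod)

end System

end OpenSystem

end

/-!
In the interaction picture the free evolution becomes conjugation by unitaries, both in the Dyson
series and in the scheme, so it remains to compare the terms order by order. The term of order
`(m, m')` is an integral over a product of two simplices; symmetrizing the integrand turns it into
an integral over a cube of side `T = n * δ`, which is cut into cells of side `δ`, one for each
assignment of the `m + m'` time points to time steps. The scheme is the midpoint rule restricted to
the cells in which no time step carries more than two points of one branch: the factor `1 / 2` in
`P₂` accounts for the two orderings of two points in the same step.

Where the points of each branch lie in distinct steps, the integrand is twice differentiable on the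
cell and averaging it with its reflection in the centre cancels the first order, leaving a relative
error `O(δ²)`. Where a step is occupied twice, symmetrization only makes the integrand Lipschitz, so
the relative error is `O(δ)`, but such cells fill only a fraction `O(1 / n)` of the cube. Triply
occupied steps, which the scheme drops, fill a fraction `O(1 / n²)`. The constants grow polynomially
in `m + m'` and are absorbed into an exponential. The sum over `m` and `m'` converges since the
number of pairings of `N` points is at most `√N!`, while the simplices have volume
`T ^ (m + m') / (m! * m'!)`.
-/

noncomputable section

namespace OpenSystem

/-! ### Values, differences and second differences -/

section SMul

variable {R X : Type*} [NormedRing R] [NormedAddCommGroup X] [Module R X] [IsBoundedSMul R X]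
  {r s : R} {x y : X} {a b d e : ℝ}

theorem norm_smul_le_of_le (hr : ‖r‖ ≤ b) (hx : ‖x‖ ≤ a) : ‖r • x‖ ≤ b * a :=
  (norm_smul_le r x).trans (mul_le_mul hr hx (norm_nonneg x) ((norm_nonneg r).trans hr))

theorem norm_smul_sub_smul_le (hr : ‖r‖ ≤ b) (hy : ‖y‖ ≤ a)
    (hsr : ‖s - r‖ ≤ b * e) (hyx : ‖y - x‖ ≤ a * d) :
    ‖s • y - r • x‖ ≤ b * a * (e + d) := by
  calc ‖s • y - r • x‖ = ‖(s - r) • y + r • (y - x)‖ := by rw [sub_smul, smul_sub]; congr 1; abel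
    _ ≤ b * e * a + b * (a * d) :=
        norm_add_le_of_le (norm_smul_le_of_le hsr hy) (norm_smul_le_of_le hr hyx)
    _ = b * a * (e + d) := by ring

end SMul

/-- `y` and `z` are the values, at two opposite displacements, of a quantity whose value at the
centre is `x`: the values are bounded by `a`, the differences by `a * d` and the second difference
by `a * d ^ 2`. The shape of the bounds makes them multiplicative: `a` multiplies and `d` adds
under products. -/
structure SecondDiffBound {X : Type*} [NormedAddCommGroup X] (x y z : X) (a d : ℝ) : Prop where
  norm_mid : ‖x‖ ≤ a
  norm_fst : ‖y‖ ≤ a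
  norm_snd : ‖z‖ ≤ a
  diff_fst : ‖y - x‖ ≤ a * d
  diff_snd : ‖z - x‖ ≤ a * d
  second_diff : ‖y + z - (x + x)‖ ≤ a * d ^ 2

namespace SecondDiffBound

section AddCommGroup

variable {X : Type*} [NormedAddCommGroup X] {x y z : X} {a d : ℝ}

theorem nonneg (h : SecondDiffBound x y z a d) : 0 ≤ a := (norm_nonneg x).trans h.norm_mid

theorem mono {a' d' : ℝ} (h : SecondDiffBound x y z a d) (hd : 0 ≤ d) (ha : a ≤ a')
    (hd' : d ≤ d') : SecondDiffBound x y z a' d' := by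
  have ha' : 0 ≤ a' := h.nonneg.trans ha
  have h_diff : a * d ≤ a' * d' := by gcongr
  have h_second : a * d ^ 2 ≤ a' * d' ^ 2 := by gcongr
  exact ⟨h.norm_mid.trans ha, h.norm_fst.trans ha, h.norm_snd.trans ha, h.diff_fst.trans h_diff,
    h.diff_snd.trans h_diff, h.second_diff.trans h_second⟩

theorem const (h : ‖x‖ ≤ a) (hd : 0 ≤ d) : SecondDiffBound x x x a d := by
  have ha : 0 ≤ a := (norm_nonneg x).trans h
  have h_diff : ‖x - x‖ ≤ a * d := by rw [sub_self, norm_zero]; positivity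
  exact ⟨h, h, h, h_diff, h_diff, by rw [sub_self, norm_zero]; positivity⟩

theorem of_tangent (hx : ‖x‖ ≤ a) (hy : ‖y‖ ≤ a) (hz : ‖z‖ ≤ a) (hyx : ‖y - x‖ ≤ a * d)
    (hzx : ‖z - x‖ ≤ a * d) {v : X} (hyv : ‖y - x - v‖ ≤ a * d ^ 2 / 2)
    (hzv : ‖z - x - -v‖ ≤ a * d ^ 2 / 2) : SecondDiffBound x y z a d := by
  refine ⟨hx, hy, hz, hyx, hzx, ?_⟩
  calc ‖y + z - (x + x)‖ = ‖y - x - v + (z - x - -v)‖ := by congr 1; abel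
    _ ≤ a * d ^ 2 / 2 + a * d ^ 2 / 2 := norm_add_le_of_le hyv hzv
    _ = a * d ^ 2 := add_halves _

theorem sum {ι : Type*} (s : Finset ι) {x y z : ι → X}
    (h : ∀ i ∈ s, SecondDiffBound (x i) (y i) (z i) a d) :
    SecondDiffBound (∑ i ∈ s, x i) (∑ i ∈ s, y i) (∑ i ∈ s, z i) (s.card * a) d := by
  have norm_sum_le (f : ι → X) (C : ℝ) (hf : ∀ i ∈ s, ‖f i‖ ≤ C) : ‖∑ i ∈ s, f i‖ ≤ s.card * C :=
    (norm_sum_le_of_le s hf).trans_eq (by rw [Finset.sum_const, nsmul_eq_mul])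
  refine ⟨norm_sum_le _ _ fun i hi => (h i hi).norm_mid, norm_sum_le _ _ fun i hi =>
    (h i hi).norm_fst, norm_sum_le _ _ fun i hi => (h i hi).norm_snd, ?_, ?_, ?_⟩ <;>
    simp only [← Finset.sum_sub_distrib, ← Finset.sum_add_distrib, mul_assoc] <;>
    refine norm_sum_le _ _ fun i hi => ?_
  exacts [(h i hi).diff_fst, (h i hi).diff_snd, (h i hi).second_diff]

theorem conj [StarAddMonoid X] [NormedStarGroup X] (h : SecondDiffBound x y z a d) :
    SecondDiffBound (star x) (star y) (star z) a d := by
  constructor <;> simp only [← star_sub, ← star_add, norm_star]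
  exacts [h.norm_mid, h.norm_fst, h.norm_snd, h.diff_fst, h.diff_snd, h.second_diff]

end AddCommGroup

section Module

variable {R X : Type*} [NormedRing R] [NormedAddCommGroup X] [Module R X] [IsBoundedSMul R X]
  {r s t : R} {x y z : X} {a b d e : ℝ}

theorem smul (hr : SecondDiffBound r s t b e) (hx : SecondDiffBound x y z a d) :
    SecondDiffBound (r • x) (s • y) (t • z) (b * a) (e + d) where
  norm_mid := norm_smul_le_of_le hr.norm_mid hx.norm_mid
  norm_fst := norm_smul_le_of_le hr.norm_fst hx.norm_fst
  norm_snd := norm_smul_le_of_le hr.norm_snd hx.norm_snd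
  diff_fst := norm_smul_sub_smul_le hr.norm_mid hx.norm_fst hr.diff_fst hx.diff_fst
  diff_snd := norm_smul_sub_smul_le hr.norm_mid hx.norm_snd hr.diff_snd hx.diff_snd
  second_diff := by
    have leibniz : s • y + t • z - (r • x + r • x) =
        (s + t - (r + r)) • x + r • (y + z - (x + x)) +
          ((s - r) • (y - x) + (t - r) • (z - x)) := by
      simp only [sub_smul, smul_sub, add_smul, smul_add]; abel
    calc ‖s • y + t • z - (r • x + r • x)‖
        ≤ b * e ^ 2 * a + b * (a * d ^ 2) + (b * e * (a * d) + b * e * (a * d)) := by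
          rw [leibniz]
          exact norm_add_le_of_le
            (norm_add_le_of_le (norm_smul_le_of_le hr.second_diff hx.norm_mid)
              (norm_smul_le_of_le hr.norm_mid hx.second_diff))
            (norm_add_le_of_le (norm_smul_le_of_le hr.diff_fst hx.diff_fst)
              (norm_smul_le_of_le hr.diff_snd hx.diff_snd))
      _ = b * a * (e + d) ^ 2 := by ring

end Module

section Ring

variable {R : Type*} [NormedRing R] {a d : ℝ}

theorem mul {r s t x y z : R} {b e : ℝ} (hr : SecondDiffBound r s t b e)
    (hx : SecondDiffBound x y z a d) : SecondDiffBound (r * x) (s * y) (t * z) (b * a) (e + d) :=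
  hr.smul hx

theorem list_prod_reverse {m : ℕ} {x y z : Fin m → R} (h_one : ‖(1 : R)‖ ≤ 1)
    (h : ∀ i, SecondDiffBound (x i) (y i) (z i) a d) :
    SecondDiffBound (List.ofFn x).reverse.prod (List.ofFn y).reverse.prod
      (List.ofFn z).reverse.prod (a ^ m) (m * d) := by
  induction m with
  | zero => simpa using const (a := 1) (d := 0) h_one le_rfl
  | succ m ih =>
    simp only [List.ofFn_succ', List.concat_eq_append, List.reverse_append, List.reverse_singleton,
      List.singleton_append, List.prod_cons]
    convert (h (Fin.last m)).mul (ih fun i => h i.castSucc) using 1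
    · rw [pow_succ']
    · push_cast; ring

theorem prod {R : Type*} [NormedCommRing R] [NormOneClass R] {ι : Type*} (s : Finset ι)
    {x y z : ι → R} (h : ∀ i ∈ s, SecondDiffBound (x i) (y i) (z i) a d) :
    SecondDiffBound (∏ i ∈ s, x i) (∏ i ∈ s, y i) (∏ i ∈ s, z i) (a ^ s.card) (s.card * d) := by
  classical
  induction s using Finset.induction_on with
  | empty => simpa using const (x := (1 : R)) (a := 1) (d := 0) norm_one.le le_rfl
  | insert i s hi ih =>
    simp only [Finset.prod_insert hi, Finset.card_insert_of_notMem hi]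
    convert (h i (Finset.mem_insert_self i s)).mul
      (ih fun j hj => h j (Finset.mem_insert_of_mem hj)) using 1
    · rw [pow_succ']
    · push_cast; ring

end Ring

end SecondDiffBound

section Taylor

variable {X : Type*} [NormedAddCommGroup X] [NormedSpace ℝ X] {g g' g'' : ℝ → X} {x y C : ℝ}

theorem norm_sub_le_of_hasDerivAt (hg : ∀ z ∈ Set.uIcc x y, HasDerivAt g (g' z) z)
    (hC : ∀ z ∈ Set.uIcc x y, ‖g' z‖ ≤ C) : ‖g y - g x‖ ≤ C * |y - x| :=
  (convex_uIcc x y).norm_image_sub_le_of_norm_hasDerivWithin_le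
    (fun z hz => (hg z hz).hasDerivWithinAt) hC Set.left_mem_uIcc Set.right_mem_uIcc

theorem norm_sub_sub_smul_le_of_hasDerivAt (hg : ∀ z ∈ Set.uIcc x y, HasDerivAt g (g' z) z)
    (hg' : ∀ z ∈ Set.uIcc x y, HasDerivAt g' (g'' z) z) (hC : ∀ z ∈ Set.uIcc x y, ‖g'' z‖ ≤ C) :
    ‖g y - g x - (y - x) • g' x‖ ≤ C * |y - x| ^ 2 := by
  have hC₀ : 0 ≤ C := (norm_nonneg _).trans (hC x Set.left_mem_uIcc)
  have h_deriv (z) (hz : z ∈ Set.uIcc x y) :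
      HasDerivAt (fun z => g z - (z - x) • g' x) (g' z - (1 : ℝ) • g' x) z :=
    (hg z hz).sub (((hasDerivAt_id z).sub_const x).smul_const (g' x))
  have h_bound (z) (hz : z ∈ Set.uIcc x y) : ‖g' z - (1 : ℝ) • g' x‖ ≤ C * |y - x| := by
    have hsub := Set.uIcc_subset_uIcc_left hz
    calc ‖g' z - (1 : ℝ) • g' x‖ ≤ C * |z - x| := by
          rw [one_smul]
          exact norm_sub_le_of_hasDerivAt (fun v hv => hg' v (hsub hv)) fun v hv => hC v (hsub hv)
      _ ≤ C * |y - x| := mul_le_mul_of_nonneg_left (Set.abs_sub_left_of_mem_uIcc hz) hC₀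
  calc ‖g y - g x - (y - x) • g' x‖
      = ‖g y - (y - x) • g' x - (g x - (x - x) • g' x)‖ := by
        rw [sub_self, zero_smul, sub_zero, sub_right_comm]
    _ ≤ C * |y - x| * |y - x| := norm_sub_le_of_hasDerivAt h_deriv h_bound
    _ = C * |y - x| ^ 2 := by ring

end Taylor

/-! ### The number of pairings -/

theorem cycleType_of_mem_pairings {N : ℕ} {σ : Equiv.Perm (Fin N)} (hσ : σ ∈ pairings N) :
    ∃ k, N = 2 * k ∧ σ.cycleType = Multiset.replicate k 2 := by
  rw [pairings, Finset.mem_filter_univ] at hσ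
  have h_sq : σ ^ 2 = 1 := by
    ext i
    simp [pow_two, (hσ i).1]
  have h_type : σ.cycleType = Multiset.replicate σ.cycleType.card 2 :=
    Multiset.eq_replicate_card.2 fun a ha => le_antisymm
      (Nat.le_of_dvd two_pos
        ((Equiv.Perm.dvd_of_mem_cycleType ha).trans (orderOf_dvd_of_pow_eq_one h_sq)))
      (Equiv.Perm.two_le_of_mem_cycleType ha)
  have h_supp : σ.support = Finset.univ := by
    ext i
    simp [(hσ i).2]
  have h_card := σ.sum_cycleType
  rw [h_type, h_supp, Multiset.sum_replicate, smul_eq_mul, Finset.card_univ,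
    Fintype.card_fin] at h_card
  exact ⟨σ.cycleType.card, h_card.symm.trans (mul_comm _ _), h_type⟩

theorem card_cycleType_replicate_two_mul (k : ℕ) :
    ({σ | σ.cycleType = Multiset.replicate k 2} : Finset (Equiv.Perm (Fin (2 * k)))).card *
      (2 ^ k * k.factorial) = (2 * k).factorial := by
  have h_card := Equiv.Perm.card_of_cycleType_mul_eq (Fin (2 * k)) (Multiset.replicate k 2)
  obtain rfl | hk := Nat.eq_zero_or_pos k
  · simpa using h_card
  · have h_valid : (Multiset.replicate k 2).sum ≤ Fintype.card (Fin (2 * k)) ∧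
        ∀ a ∈ Multiset.replicate k 2, 2 ≤ a :=
      ⟨by simp [mul_comm], fun a ha => (Multiset.eq_of_mem_replicate ha).ge⟩
    rw [if_pos h_valid] at h_card
    simpa [Multiset.toFinset_replicate, hk.ne', mul_comm k 2] using h_card

theorem factorial_two_mul_le (k : ℕ) : (2 * k).factorial ≤ (2 ^ k * k.factorial) ^ 2 :=
  calc (2 * k).factorial = (2 * k).choose k * k.factorial * k.factorial := by
        rw [two_mul, Nat.add_choose_mul_factorial_mul_factorial]
    _ ≤ 2 ^ (2 * k) * k.factorial * k.factorial := by gcongr; exact Nat.choose_le_two_pow _ _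
    _ = (2 ^ k * k.factorial) ^ 2 := by ring

theorem card_pairings_sq_le (N : ℕ) : (pairings N).card ^ 2 ≤ N.factorial := by
  obtain h_empty | ⟨σ, hσ⟩ := (pairings N).eq_empty_or_nonempty
  · simp [h_empty]
  obtain ⟨k, rfl, -⟩ := cycleType_of_mem_pairings hσ
  have h_sub : pairings (2 * k) ⊆ ({τ | τ.cycleType = Multiset.replicate k 2} : Finset _) := by
    intro τ hτ
    obtain ⟨l, hl, hτl⟩ := cycleType_of_mem_pairings hτ
    obtain rfl : k = l := by omega
    simpa using hτl
  have h_le : (pairings (2 * k)).card * (2 ^ k * k.factorial) ≤ (2 * k).factorial :=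
    (Nat.mul_le_mul_right _ (Finset.card_le_card h_sub)).trans_eq
      (card_cycleType_replicate_two_mul k)
  refine Nat.le_of_mul_le_mul_right ?_ (show 0 < (2 ^ k * k.factorial) ^ 2 by positivity)
  calc (pairings (2 * k)).card ^ 2 * (2 ^ k * k.factorial) ^ 2
      = ((pairings (2 * k)).card * (2 ^ k * k.factorial)) ^ 2 := (mul_pow _ _ _).symm
    _ ≤ (2 * k).factorial ^ 2 := Nat.pow_le_pow_left h_le 2
    _ = (2 * k).factorial * (2 * k).factorial := pow_two _
    _ ≤ (2 * k).factorial * (2 ^ k * k.factorial) ^ 2 :=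
        Nat.mul_le_mul_left _ (factorial_two_mul_le k)

/-! ### Regularity of the influence functional -/

/-- `y` is displaced from `x` by at most `δ` in each coordinate, without reaching `0`, and `z` is
the reflection of `y` in `x`. The bath correlation function is smooth along such displacements
because they do not meet the axes. -/
def Reflects {ι : Type*} (δ : ℝ) (x y z : ι → ℝ) : Prop :=
  ∀ i, |y i - x i| ≤ δ ∧ |y i - x i| < |x i| ∧ z i = 2 * x i - y i

namespace Reflects

variable {ι κ : Type*} {δ : ℝ} {x y z : ι → ℝ}

theorem comp (h : Reflects δ x y z) (f : κ → ι) : Reflects δ (x ∘ f) (y ∘ f) (z ∘ f) :=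
  fun i => h (f i)

theorem sub_eq_neg_sub (h : Reflects δ x y z) (i : ι) : z i - x i = -(y i - x i) := by
  rw [(h i).2.2]; ring

theorem symm (h : Reflects δ x y z) : Reflects δ x z y := fun i => by
  rw [h.sub_eq_neg_sub, abs_neg]
  exact ⟨(h i).1, (h i).2.1, by rw [(h i).2.2]; ring⟩

end Reflects

theorem ne_zero_of_mem_uIcc {x y z : ℝ} (hz : z ∈ Set.uIcc x y) (h : |y - x| < |x|) : z ≠ 0 := by
  rintro rfl
  have := Set.abs_sub_left_of_mem_uIcc hz
  rw [zero_sub, abs_neg] at this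
  exact this.not_gt h

theorem card_filter_lt_perm_le {N : ℕ} (σ : Equiv.Perm (Fin N)) :
    (Finset.univ.filter fun i : Fin N => i < σ i).card ≤ N :=
  (Finset.card_filter_le _ _).trans_eq (Finset.card_fin N)

namespace BathBounds

variable {B : ℝ → ℝ → ℂ} {b b' b'' : ℝ}

theorem swap (hB : BathBounds B b b' b'') : BathBounds (fun x y => B y x) b b' b'' where
  bound x y := hB.bound y x
  partials x y hx hy := (hB.partials y x hy hx).symm
  bound' x y hx hy := (add_comm _ _).trans_le (hB.bound' y x hy hx)
  partials₁ x y hx hy := (hB.partials₂ y x hy hx).symm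
  partials₂ x y hx hy := (hB.partials₁ y x hy hx).symm
  bound₁₁ x y hx hy := hB.bound₂₂ y x hy hx
  bound₂₁ x y hx hy := hB.bound₁₂ y x hy hx
  bound₁₂ x y hx hy := hB.bound₂₁ y x hy hx
  bound₂₂ x y hx hy := hB.bound₁₁ y x hy hx

theorem nonneg (hB : BathBounds B b b' b'') : 0 ≤ b :=
  (norm_nonneg _).trans (hB.bound 0 0)

theorem nonneg' (hB : BathBounds B b b' b'') : 0 ≤ b' :=
  (add_nonneg (norm_nonneg _) (norm_nonneg _)).trans (hB.bound' 1 1 one_ne_zero one_ne_zero)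

theorem nonneg'' (hB : BathBounds B b b' b'') : 0 ≤ b'' :=
  (norm_nonneg _).trans (hB.bound₁₁ 1 1 one_ne_zero one_ne_zero)

variable {x x' y y' δ : ℝ}

theorem norm_sub_le_left (hB : BathBounds B b b' b'') (hx : |x' - x| < |x|) (hy : y ≠ 0) :
    ‖B x' y - B x y‖ ≤ b' * |x' - x| :=
  norm_sub_le_of_hasDerivAt (g := fun x => B x y) (g' := fun x => pderiv₁ B x y)
    (fun z hz => (hB.partials z y (ne_zero_of_mem_uIcc hz hx) hy).1.hasDerivAt)
    fun z hz => (le_add_of_nonneg_right (norm_nonneg _)).trans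
      (hB.bound' z y (ne_zero_of_mem_uIcc hz hx) hy)

theorem norm_sub_sub_pderiv_le_left (hB : BathBounds B b b' b'') (hx : |x' - x| < |x|)
    (hy : y ≠ 0) : ‖B x' y - B x y - (x' - x) • pderiv₁ B x y‖ ≤ b'' * |x' - x| ^ 2 :=
  norm_sub_sub_smul_le_of_hasDerivAt (g := fun x => B x y) (g' := fun x => pderiv₁ B x y)
    (fun z hz => (hB.partials z y (ne_zero_of_mem_uIcc hz hx) hy).1.hasDerivAt)
    (fun z hz => (hB.partials₁ z y (ne_zero_of_mem_uIcc hz hx) hy).1.hasDerivAt)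
    fun z hz => hB.bound₁₁ z y (ne_zero_of_mem_uIcc hz hx) hy

theorem norm_pderiv₁_sub_le_right (hB : BathBounds B b b' b'') (hx : x ≠ 0)
    (hy : |y' - y| < |y|) : ‖pderiv₁ B x y' - pderiv₁ B x y‖ ≤ b'' * |y' - y| :=
  norm_sub_le_of_hasDerivAt (g := pderiv₁ B x) (g' := pderiv₂ (pderiv₁ B) x)
    (fun z hz => (hB.partials₁ x z hx (ne_zero_of_mem_uIcc hz hy)).2.hasDerivAt)
    fun z hz => hB.bound₂₁ x z hx (ne_zero_of_mem_uIcc hz hy)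

theorem norm_sub_le (hB : BathBounds B b b' b'') (hx : |x' - x| < |x|) (hy : |y' - y| < |y|)
    (hxδ : |x' - x| ≤ δ) (hyδ : |y' - y| ≤ δ) : ‖B x' y' - B x y‖ ≤ 2 * b' * δ := by
  have hx₀ : x ≠ 0 := ne_zero_of_mem_uIcc Set.left_mem_uIcc hx
  have hy₀ : y' ≠ 0 := ne_zero_of_mem_uIcc Set.right_mem_uIcc hy
  calc ‖B x' y' - B x y‖ = ‖B x' y' - B x y' + (B x y' - B x y)‖ := by rw [sub_add_sub_cancel]
    _ ≤ b' * |x' - x| + b' * |y' - y| :=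
        norm_add_le_of_le (hB.norm_sub_le_left hx hy₀) (hB.swap.norm_sub_le_left hy hx₀)
    _ ≤ b' * δ + b' * δ := by have := hB.nonneg'; gcongr
    _ = 2 * b' * δ := by ring

theorem norm_sub_sub_pderiv_le (hB : BathBounds B b b' b'') (hx : |x' - x| < |x|)
    (hy : |y' - y| < |y|) (hxδ : |x' - x| ≤ δ) (hyδ : |y' - y| ≤ δ) :
    ‖B x' y' - B x y - ((x' - x) • pderiv₁ B x y + (y' - y) • pderiv₂ B x y)‖ ≤
      3 * b'' * δ ^ 2 := by
  have hδ : 0 ≤ δ := (abs_nonneg _).trans hxδ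
  have hx₀ : x ≠ 0 := ne_zero_of_mem_uIcc Set.left_mem_uIcc hx
  have hy₀ : y' ≠ 0 := ne_zero_of_mem_uIcc Set.right_mem_uIcc hy
  have h_mixed : ‖(x' - x) • (pderiv₁ B x y' - pderiv₁ B x y)‖ ≤ |x' - x| * (b'' * |y' - y|) :=
    norm_smul_le_of_le le_rfl (hB.norm_pderiv₁_sub_le_right hx₀ hy)
  calc ‖B x' y' - B x y - ((x' - x) • pderiv₁ B x y + (y' - y) • pderiv₂ B x y)‖
      = ‖(B x' y' - B x y' - (x' - x) • pderiv₁ B x y') +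
          (B x y' - B x y - (y' - y) • pderiv₂ B x y) +
          (x' - x) • (pderiv₁ B x y' - pderiv₁ B x y)‖ := by rw [smul_sub]; congr 1; abel
    _ ≤ b'' * |x' - x| ^ 2 + b'' * |y' - y| ^ 2 + |x' - x| * (b'' * |y' - y|) :=
        norm_add_le_of_le (norm_add_le_of_le (hB.norm_sub_sub_pderiv_le_left hx hy₀)
          (hB.swap.norm_sub_sub_pderiv_le_left hy hx₀)) h_mixed
    _ ≤ b'' * δ ^ 2 + b'' * δ ^ 2 + δ * (b'' * δ) := by have := hB.nonneg''; gcongr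
    _ = 3 * b'' * δ ^ 2 := by ring

theorem secondDiffBound (hB : BathBounds B b b' b'') {ι : Type*} {x y z : ι → ℝ}
    (h : Reflects δ x y z) (i j : ι) :
    SecondDiffBound (B (x i) (x j)) (B (y i) (y j)) (B (z i) (z j)) (1 + b)
      ((1 + 2 * b' + 6 * b'') * δ) := by
  have hb := hB.nonneg
  have hb' := hB.nonneg'
  have hb'' := hB.nonneg''
  have hδ : 0 ≤ δ := (abs_nonneg _).trans (h i).1
  have h_bound (u v : ℝ) : ‖B u v‖ ≤ 1 + b := (hB.bound u v).trans (by linarith)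
  have h_diff {z y : ι → ℝ} (h : Reflects δ x y z) :
      ‖B (y i) (y j) - B (x i) (x j)‖ ≤ (1 + b) * ((1 + 2 * b' + 6 * b'') * δ) :=
    calc _ ≤ 2 * b' * δ := hB.norm_sub_le (h i).2.1 (h j).2.1 (h i).1 (h j).1
      _ ≤ 1 * ((1 + 2 * b' + 6 * b'') * δ) := by rw [one_mul]; gcongr; linarith
      _ ≤ _ := by gcongr; linarith
  have h_tangent {z y : ι → ℝ} (h : Reflects δ x y z) :
      ‖B (y i) (y j) - B (x i) (x j) - ((y i - x i) • pderiv₁ B (x i) (x j) +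
        (y j - x j) • pderiv₂ B (x i) (x j))‖ ≤
        (1 + b) * ((1 + 2 * b' + 6 * b'') * δ) ^ 2 / 2 :=
    calc _ ≤ 3 * b'' * δ ^ 2 := hB.norm_sub_sub_pderiv_le (h i).2.1 (h j).2.1 (h i).1 (h j).1
      _ = 1 * (6 * b'' * δ ^ 2) / 2 := by ring
      _ ≤ (1 + b) * ((1 + 2 * b' + 6 * b'') ^ 2 * δ ^ 2) / 2 := by
          gcongr
          · linarith
          · nlinarith [mul_nonneg hb' hb'']
      _ = _ := by ring
  refine .of_tangent (h_bound _ _) (h_bound _ _) (h_bound _ _) (h_diff h) (h_diff h.symm)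
    (h_tangent h) ?_
  simpa only [h.sub_eq_neg_sub, neg_smul, ← neg_add] using h_tangent h.symm

theorem continuousAt (hB : BathBounds B b b' b'') (hx : x ≠ 0) (hy : y ≠ 0) :
    ContinuousAt (fun p : ℝ × ℝ => B p.1 p.2) (x, y) := by
  refine continuousAt_of_locally_lipschitz (r := min |x| |y|) (by positivity) (2 * b') ?_
  rintro ⟨x', y'⟩ h
  rw [Prod.dist_eq, max_lt_iff, lt_min_iff, lt_min_iff] at h
  rw [dist_eq_norm]
  exact hB.norm_sub_le h.1.1 h.2.2 (le_max_left _ _) (le_max_right _ _)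

section Influence

variable {N : ℕ}

theorem bathInfluence_secondDiffBound (hB : BathBounds B b b' b'') {x y z : Fin N → ℝ}
    (hδ : 0 ≤ δ) (h : Reflects δ x y z) :
    SecondDiffBound (bathInfluence B x) (bathInfluence B y) (bathInfluence B z)
      ((pairings N).card * (1 + b) ^ N) (N * ((1 + 2 * b' + 6 * b'') * δ)) := by
  have hb := hB.nonneg
  have hb' := hB.nonneg'
  have hb'' := hB.nonneg''
  refine SecondDiffBound.sum _ fun σ _ =>
    (SecondDiffBound.prod _ fun i _ => hB.secondDiffBound h i (σ i)).mono (by positivity) ?_ ?_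
  · exact pow_le_pow_right₀ (by linarith) (card_filter_lt_perm_le σ)
  · gcongr
    exact card_filter_lt_perm_le σ

theorem norm_bathInfluence_le (hB : BathBounds B b b' b'') (x : Fin N → ℝ) :
    ‖bathInfluence B x‖ ≤ (pairings N).card * (1 + b) ^ N := by
  have h_prod (σ : Equiv.Perm (Fin N)) :
      ‖∏ i : Fin N with i < σ i, B (x i) (x (σ i))‖ ≤ (1 + b) ^ N :=
    calc _ = ∏ i : Fin N with i < σ i, ‖B (x i) (x (σ i))‖ := norm_prod _ _
      _ ≤ ∏ i : Fin N with i < σ i, (1 + b) := Finset.prod_le_prod (fun _ _ => norm_nonneg _)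
          fun i _ => (hB.bound _ _).trans (le_add_of_nonneg_left zero_le_one)
      _ = (1 + b) ^ (Finset.univ.filter fun i : Fin N => i < σ i).card := Finset.prod_const _
      _ ≤ (1 + b) ^ N := pow_le_pow_right₀ (le_add_of_nonneg_right hB.nonneg)
          (card_filter_lt_perm_le σ)
  exact (norm_sum_le_of_le _ fun σ _ => h_prod σ).trans_eq
    (by rw [Finset.sum_const, nsmul_eq_mul])

theorem continuousAt_bathInfluence (hB : BathBounds B b b' b'') {x : Fin N → ℝ}
    (hx : ∀ i, x i ≠ 0) : ContinuousAt (bathInfluence B) x := by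
  refine tendsto_finsetSum _ fun σ _ => tendsto_finsetProd _ fun i _ => ?_
  have h_pair : ContinuousAt (fun x : Fin N → ℝ => (x i, x (σ i))) x := by fun_prop
  exact ContinuousAt.comp (f := fun x : Fin N → ℝ => (x i, x (σ i)))
    (g := fun p : ℝ × ℝ => B p.1 p.2) (hB.continuousAt (hx i) (hx (σ i))) h_pair

end Influence

end BathBounds

/-! ### The interaction picture -/

section Interaction

variable {E : Type*} [NormedAddCommGroup E] [InnerProductSpace ℂ E] [CompleteSpace E]

theorem freeProp_eq_exp_smul (Hs : E →L[ℂ] E) (t : ℝ) :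
    freeProp Hs t = NormedSpace.exp (t • ((-Complex.I) • Hs)) := by
  rw [freeProp, ← Complex.coe_smul, smul_smul, mul_comm]

theorem freeProp_zero (Hs : E →L[ℂ] E) : freeProp Hs 0 = 1 := by
  rw [freeProp_eq_exp_smul, zero_smul, NormedSpace.exp_zero]

theorem freeProp_add (Hs : E →L[ℂ] E) (s t : ℝ) :
    freeProp Hs (s + t) = freeProp Hs s * freeProp Hs t := by
  let +nondep : NormedAlgebra ℚ (E →L[ℂ] E) := .restrictScalars ℚ ℂ (E →L[ℂ] E)
  simp only [freeProp_eq_exp_smul, add_smul]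
  exact NormedSpace.exp_add_of_commute (((Commute.refl _).smul_left s).smul_right t)

theorem freeProp_mul_freeProp_neg (Hs : E →L[ℂ] E) (s : ℝ) :
    freeProp Hs s * freeProp Hs (-s) = 1 := by
  rw [← freeProp_add, add_neg_cancel, freeProp_zero]

theorem star_freeProp {Hs : E →L[ℂ] E} (hH : IsSelfAdjoint Hs) (t : ℝ) :
    star (freeProp Hs t) = freeProp Hs (-t) := by
  rw [freeProp, freeProp, NormedSpace.star_exp, star_smul, hH.star_eq]
  simp

theorem norm_freeProp_le {Hs : E →L[ℂ] E} (hH : IsSelfAdjoint Hs) (t : ℝ) :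
    ‖freeProp Hs t‖ ≤ 1 := by
  refine le_of_sq_le_sq ?_ zero_le_one
  calc ‖freeProp Hs t‖ ^ 2 = ‖star (freeProp Hs t) * freeProp Hs t‖ := by
        rw [CStarRing.norm_star_mul_self, pow_two]
    _ = ‖(1 : E →L[ℂ] E)‖ := by
        rw [star_freeProp hH, ← freeProp_add, neg_add_cancel, freeProp_zero]
    _ ≤ 1 ^ 2 := by rw [one_pow]; exact ContinuousLinearMap.norm_id_le

theorem norm_freeProp_mul_mul_freeProp_le {Hs : E →L[ℂ] E} (hH : IsSelfAdjoint Hs) (s t : ℝ)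
    (X : E →L[ℂ] E) : ‖freeProp Hs s * X * freeProp Hs t‖ ≤ ‖X‖ :=
  calc _ ≤ ‖freeProp Hs s‖ * ‖X‖ * ‖freeProp Hs t‖ := norm_mul₃_le
    _ ≤ 1 * ‖X‖ * 1 := by gcongr <;> exact norm_freeProp_le hH _
    _ = ‖X‖ := by ring

theorem hasDerivAt_freeProp (Hs : E →L[ℂ] E) (t : ℝ) :
    HasDerivAt (freeProp Hs) (freeProp Hs t * ((-Complex.I) • Hs)) t := by
  simpa only [← freeProp_eq_exp_smul] using
    hasDerivAt_exp_smul_const (𝕂 := ℝ) ((-Complex.I) • Hs) t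

theorem commute_freeProp (Hs : E →L[ℂ] E) (t : ℝ) : Commute (freeProp Hs t) Hs :=
  ((Commute.refl Hs).smul_left _).exp_left

/-- The operator `X` in the interaction picture at time `s`. -/
def interaction (Hs X : E →L[ℂ] E) (s : ℝ) : E →L[ℂ] E :=
  freeProp Hs (-s) * X * freeProp Hs s

/-- The commutator `i [Hs, X]`, the generator of the interaction picture. -/
def heisenberg (Hs X : E →L[ℂ] E) : E →L[ℂ] E :=
  Complex.I • (Hs * X - X * Hs)

theorem norm_heisenberg_le (Hs X : E →L[ℂ] E) : ‖heisenberg Hs X‖ ≤ 2 * ‖Hs‖ * ‖X‖ :=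
  calc ‖heisenberg Hs X‖ = ‖Hs * X - X * Hs‖ := by
        rw [heisenberg, norm_smul, Complex.norm_I, one_mul]
    _ ≤ ‖Hs‖ * ‖X‖ + ‖X‖ * ‖Hs‖ := norm_sub_le_of_le (norm_mul_le _ _) (norm_mul_le _ _)
    _ = 2 * ‖Hs‖ * ‖X‖ := by ring

theorem hasDerivAt_interaction (Hs X : E →L[ℂ] E) (s : ℝ) :
    HasDerivAt (interaction Hs X) (interaction Hs (heisenberg Hs X) s) s := by
  have h_neg : HasDerivAt (fun s => freeProp Hs (-s))
      (-(freeProp Hs (-s) * ((-Complex.I) • Hs))) s := by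
    have h := (hasDerivAt_freeProp Hs (-s)).scomp s (hasDerivAt_neg s)
    rw [neg_one_smul] at h
    exact h
  refine ((h_neg.mul_const X).mul (hasDerivAt_freeProp Hs s)).congr_deriv ?_
  simp only [interaction, heisenberg, mul_smul_comm, smul_mul_assoc, neg_smul, mul_neg, neg_neg,
    (commute_freeProp Hs s).eq, mul_sub, sub_mul, smul_sub, mul_assoc]
  abel

theorem continuous_interaction (Hs X : E →L[ℂ] E) : Continuous (interaction Hs X) :=
  continuous_iff_continuousAt.2 fun s => (hasDerivAt_interaction Hs X s).continuousAt

section SelfAdjoint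

variable {Hs : E →L[ℂ] E}

theorem norm_interaction_le (hH : IsSelfAdjoint Hs) (X : E →L[ℂ] E) (s : ℝ) :
    ‖interaction Hs X s‖ ≤ ‖X‖ :=
  norm_freeProp_mul_mul_freeProp_le hH _ _ X

theorem norm_interaction_sub_le (hH : IsSelfAdjoint Hs) (X : E →L[ℂ] E) (s s' : ℝ) :
    ‖interaction Hs X s' - interaction Hs X s‖ ≤ 2 * ‖Hs‖ * ‖X‖ * |s' - s| :=
  norm_sub_le_of_hasDerivAt (fun z _ => hasDerivAt_interaction Hs X z) fun z _ =>
    (norm_interaction_le hH _ z).trans (norm_heisenberg_le Hs X)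

theorem norm_interaction_sub_sub_le (hH : IsSelfAdjoint Hs) (X : E →L[ℂ] E) (s s' : ℝ) :
    ‖interaction Hs X s' - interaction Hs X s - (s' - s) • interaction Hs (heisenberg Hs X) s‖ ≤
      4 * ‖Hs‖ ^ 2 * ‖X‖ * |s' - s| ^ 2 := by
  refine norm_sub_sub_smul_le_of_hasDerivAt (fun z _ => hasDerivAt_interaction Hs X z)
    (fun z _ => hasDerivAt_interaction Hs (heisenberg Hs X) z) fun z _ => ?_
  calc _ ≤ ‖heisenberg Hs (heisenberg Hs X)‖ := norm_interaction_le hH _ z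
    _ ≤ 2 * ‖Hs‖ * (2 * ‖Hs‖ * ‖X‖) := (norm_heisenberg_le Hs _).trans
        (mul_le_mul_of_nonneg_left (norm_heisenberg_le Hs X) (by positivity))
    _ = 4 * ‖Hs‖ ^ 2 * ‖X‖ := by ring

theorem interaction_secondDiffBound (hH : IsSelfAdjoint Hs) (X : E →L[ℂ] E) {ι : Type*}
    {x y z : ι → ℝ} {δ : ℝ} (h : Reflects δ x y z) (i : ι) :
    SecondDiffBound (interaction Hs X (x i)) (interaction Hs X (y i)) (interaction Hs X (z i))
      ‖X‖ (4 * ‖Hs‖ * δ) := by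
  have : 0 ≤ δ := (abs_nonneg _).trans (h i).1
  have h_diff {y z : ι → ℝ} (h : Reflects δ x y z) :
      ‖interaction Hs X (y i) - interaction Hs X (x i)‖ ≤ ‖X‖ * (4 * ‖Hs‖ * δ) :=
    calc _ ≤ 2 * ‖Hs‖ * ‖X‖ * |y i - x i| := norm_interaction_sub_le hH X _ _
      _ ≤ 4 * ‖Hs‖ * ‖X‖ * δ := by gcongr; exacts [by norm_num, (h i).1]
      _ = _ := by ring
  have h_tangent {y z : ι → ℝ} (h : Reflects δ x y z) :
      ‖interaction Hs X (y i) - interaction Hs X (x i) -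
        (y i - x i) • interaction Hs (heisenberg Hs X) (x i)‖ ≤ ‖X‖ * (4 * ‖Hs‖ * δ) ^ 2 / 2 :=
    calc _ ≤ 4 * ‖Hs‖ ^ 2 * ‖X‖ * |y i - x i| ^ 2 := norm_interaction_sub_sub_le hH X _ _
      _ ≤ 8 * ‖Hs‖ ^ 2 * ‖X‖ * δ ^ 2 := by gcongr; exacts [by norm_num, (h i).1]
      _ = _ := by ring
  refine .of_tangent (norm_interaction_le hH _ _) (norm_interaction_le hH _ _)
    (norm_interaction_le hH _ _) (h_diff h) (h_diff h.symm) (h_tangent h) ?_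
  simpa only [h.sub_eq_neg_sub, neg_smul] using h_tangent h.symm

end SelfAdjoint

/-- The time-ordered product `X(s_m) ⋯ X(s_1)` in the interaction picture. -/
def interactionProd (Hs X : E →L[ℂ] E) {m : ℕ} (s : Fin m → ℝ) : E →L[ℂ] E :=
  (List.ofFn fun i => interaction Hs X (s i)).reverse.prod

theorem interactionProd_succ (Hs X : E →L[ℂ] E) {m : ℕ} (s : Fin (m + 1) → ℝ) :
    interactionProd Hs X s =
      interaction Hs X (s (Fin.last m)) * interactionProd Hs X (Fin.init s) := by
  simp only [interactionProd, List.ofFn_succ', List.concat_eq_append, List.reverse_append,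
    List.reverse_singleton, List.singleton_append, List.prod_cons, Fin.init]

theorem continuous_interactionProd (Hs X : E →L[ℂ] E) {m : ℕ} :
    Continuous fun s : Fin m → ℝ => interactionProd Hs X s := by
  induction m with
  | zero => simpa [interactionProd] using continuous_const
  | succ m ih =>
    simp only [interactionProd_succ]
    exact ((continuous_interaction Hs X).comp (continuous_apply _)).mul
      (ih.comp (continuous_pi fun i => continuous_apply i.castSucc))

theorem interactionProd_secondDiffBound {Hs : E →L[ℂ] E} (hH : IsSelfAdjoint Hs) (X : E →L[ℂ] E)
    {m : ℕ} {x y z : Fin m → ℝ} {δ : ℝ} (h : Reflects δ x y z) :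
    SecondDiffBound (interactionProd Hs X x) (interactionProd Hs X y) (interactionProd Hs X z)
      (‖X‖ ^ m) (m * (4 * ‖Hs‖ * δ)) :=
  .list_prod_reverse ContinuousLinearMap.norm_id_le fun i => interaction_secondDiffBound hH X h i

theorem norm_interactionProd_le {Hs : E →L[ℂ] E} (hH : IsSelfAdjoint Hs) (X : E →L[ℂ] E) {m : ℕ}
    (s : Fin m → ℝ) : ‖interactionProd Hs X s‖ ≤ ‖X‖ ^ m :=
  (SecondDiffBound.list_prod_reverse (d := 0) ContinuousLinearMap.norm_id_le fun i =>
    .const (norm_interaction_le hH X (s i)) le_rfl).norm_mid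

theorem leftDyson_eq (Hs Ws : E →L[ℂ] E) {m : ℕ} (s : Fin m → ℝ) (t : ℝ) :
    leftDyson Hs Ws m s t = freeProp Hs t * interactionProd Hs Ws s := by
  induction m generalizing t with
  | zero => simp [leftDyson, interactionProd]
  | succ m ih =>
    rw [leftDyson, ih, interactionProd_succ, interaction, sub_eq_add_neg, freeProp_add]
    simp only [mul_assoc]

theorem rightDyson_eq_star {Hs Ws : E →L[ℂ] E} (hH : IsSelfAdjoint Hs) (hW : IsSelfAdjoint Ws)
    {m : ℕ} (s : Fin m → ℝ) (t : ℝ) :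
    rightDyson Hs Ws m s t = star (leftDyson Hs Ws m s t) := by
  induction m generalizing t with
  | zero => rw [rightDyson, leftDyson, star_freeProp hH]
  | succ m ih =>
    rw [rightDyson, leftDyson, ih]
    simp only [star_mul, star_freeProp hH, hW.star_eq, mul_assoc]

end Interaction

/-! ### The kernel of the Dyson series -/

section SignedTimes

variable {m m' : ℕ}

/-- The time points `-t_m, …, -t_1, t'_1, …, t'_{m'}` at which the influence functional is
evaluated. -/
def signedTimes (s : (Fin m → ℝ) × (Fin m' → ℝ)) : Fin (m + m') → ℝ :=
  Fin.append (fun i => -s.1 (Fin.rev i)) s.2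

theorem Reflects.signedTimes {δ : ℝ} {x y z : Fin m → ℝ} {x' y' z' : Fin m' → ℝ}
    (h : Reflects δ x y z) (h' : Reflects δ x' y' z') :
    Reflects δ (signedTimes (x, x')) (signedTimes (y, y')) (signedTimes (z, z')) := by
  intro i
  induction i using Fin.addCases with
  | left i =>
    obtain ⟨h_le, h_lt, h_eq⟩ := h (Fin.rev i)
    simp only [OpenSystem.signedTimes, Fin.append_left, neg_sub_neg, abs_neg,
      abs_sub_comm (x _) (y _)]
    exact ⟨h_le, h_lt, by rw [h_eq]; ring⟩
  | right i => simpa only [OpenSystem.signedTimes, Fin.append_right] using h' i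

theorem signedTimes_ne_zero {s : (Fin m → ℝ) × (Fin m' → ℝ)} (hs : ∀ i, s.1 i ≠ 0)
    (hs' : ∀ i, s.2 i ≠ 0) (i : Fin (m + m')) : signedTimes s i ≠ 0 := by
  induction i using Fin.addCases with
  | left i => simpa [signedTimes] using hs (Fin.rev i)
  | right i => simpa [signedTimes] using hs' i

theorem continuous_signedTimes :
    Continuous (signedTimes : (Fin m → ℝ) × (Fin m' → ℝ) → Fin (m + m') → ℝ) := by
  refine continuous_pi fun i => ?_
  induction i using Fin.addCases with
  | left i => simp only [signedTimes, Fin.append_left]; fun_prop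
  | right i => simp only [signedTimes, Fin.append_right]; fun_prop

/-- `f` satisfies `SecondDiffBound` with constants `M` and `d` under all displacements of size `δ`
of its arguments that stay away from `0`. -/
def HasSecondDiffBound {X : Type*} [NormedAddCommGroup X] (f : (Fin m → ℝ) × (Fin m' → ℝ) → X)
    (δ M d : ℝ) : Prop :=
  ∀ ⦃x y z : Fin m → ℝ⦄ ⦃x' y' z' : Fin m' → ℝ⦄, Reflects δ x y z → Reflects δ x' y' z' →
    SecondDiffBound (f (x, x')) (f (y, y')) (f (z, z')) M d

end SignedTimes

section Kernel

variable {E : Type*} [NormedAddCommGroup E] [InnerProductSpace ℂ E] [CompleteSpace E]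
  {Hs Ws ρ₀ : E →L[ℂ] E} {B : ℝ → ℝ → ℂ} {b b' b'' : ℝ} {m m' : ℕ}

/-- The integrand of the `(m, m')` term of the Dyson series in the interaction picture; unlike
`dysonIntegrand` it does not depend on the final time. -/
def kernel (Hs Ws ρ₀ : E →L[ℂ] E) (B : ℝ → ℝ → ℂ) (s : (Fin m → ℝ) × (Fin m' → ℝ)) :
    E →L[ℂ] E :=
  ((-Complex.I) ^ m * Complex.I ^ m' * bathInfluence B (signedTimes s)) •
    (interactionProd Hs Ws s.1 * ρ₀ * star (interactionProd Hs Ws s.2))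

theorem dysonIntegrand_eq (hH : IsSelfAdjoint Hs) (hW : IsSelfAdjoint Ws) (t : ℝ)
    (s : (Fin m → ℝ) × (Fin m' → ℝ)) :
    dysonIntegrand Hs Ws ρ₀ B t m m' s =
      freeProp Hs t * kernel Hs Ws ρ₀ B s * freeProp Hs (-t) := by
  rw [dysonIntegrand, kernel, rightDyson_eq_star hH hW, leftDyson_eq, leftDyson_eq, star_mul,
    star_freeProp hH, mul_smul_comm, smul_mul_assoc]
  simp only [mul_assoc, signedTimes]

theorem norm_neg_I_pow_mul_I_pow (m m' : ℕ) : ‖(-Complex.I) ^ m * Complex.I ^ m'‖ = 1 := by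
  simp

theorem hasSecondDiffBound_kernel (hH : IsSelfAdjoint Hs) (hB : BathBounds B b b' b'') {δ : ℝ}
    (hδ : 0 ≤ δ) :
    HasSecondDiffBound (kernel (m := m) (m' := m') Hs Ws ρ₀ B) δ
      ((pairings (m + m')).card * (‖ρ₀‖ * ((1 + b) * ‖Ws‖) ^ (m + m')))
      ((m + m' : ℕ) * ((1 + 2 * b' + 6 * b'' + 4 * ‖Hs‖) * δ)) := by
  intro x y z x' y' z' h h'
  have h_coeff := SecondDiffBound.const (d := 0) (norm_neg_I_pow_mul_I_pow m m').le le_rfl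
  have h_bath := hB.bathInfluence_secondDiffBound hδ (h.signedTimes h')
  have h_left := interactionProd_secondDiffBound hH Ws h
  have h_right := (interactionProd_secondDiffBound hH Ws h').conj
  have h_mid := SecondDiffBound.const (x := ρ₀) (d := 0) le_rfl le_rfl
  have h_prod := (h_coeff.mul h_bath).smul ((h_left.mul h_mid).mul h_right)
  have h_norm : 1 * ((pairings (m + m')).card * (1 + b) ^ (m + m')) *
      (‖Ws‖ ^ m * ‖ρ₀‖ * ‖Ws‖ ^ m') =
        (pairings (m + m')).card * (‖ρ₀‖ * ((1 + b) * ‖Ws‖) ^ (m + m')) := by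
    rw [mul_pow]; ring
  have h_diff : 0 + (m + m' : ℕ) * ((1 + 2 * b' + 6 * b'') * δ) +
      (m * (4 * ‖Hs‖ * δ) + 0 + m' * (4 * ‖Hs‖ * δ)) =
        (m + m' : ℕ) * ((1 + 2 * b' + 6 * b'' + 4 * ‖Hs‖) * δ) := by
    push_cast; ring
  rw [h_norm, h_diff] at h_prod
  exact h_prod

theorem norm_kernel_le (hH : IsSelfAdjoint Hs) (hB : BathBounds B b b' b'')
    (s : (Fin m → ℝ) × (Fin m' → ℝ)) :
    ‖kernel Hs Ws ρ₀ B s‖ ≤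
      (pairings (m + m')).card * (‖ρ₀‖ * ((1 + b) * ‖Ws‖) ^ (m + m')) := by
  have h_coeff : ‖(-Complex.I) ^ m * Complex.I ^ m' * bathInfluence B (signedTimes s)‖ ≤
      1 * ((pairings (m + m')).card * (1 + b) ^ (m + m')) :=
    norm_mul_le_of_le (norm_neg_I_pow_mul_I_pow m m').le (hB.norm_bathInfluence_le _)
  have h_prod : ‖interactionProd Hs Ws s.1 * ρ₀ * star (interactionProd Hs Ws s.2)‖ ≤
      ‖Ws‖ ^ m * ‖ρ₀‖ * ‖Ws‖ ^ m' :=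
    norm_mul_le_of_le (norm_mul_le_of_le (norm_interactionProd_le hH Ws s.1) le_rfl)
      ((norm_star _).trans_le (norm_interactionProd_le hH Ws s.2))
  exact (norm_smul_le_of_le h_coeff h_prod).trans_eq (by rw [mul_pow]; ring)

theorem continuousAt_kernel (hB : BathBounds B b b' b'') {s : (Fin m → ℝ) × (Fin m' → ℝ)}
    (hs : ∀ i, s.1 i ≠ 0) (hs' : ∀ i, s.2 i ≠ 0) : ContinuousAt (kernel Hs Ws ρ₀ B) s := by
  have h_bath : ContinuousAt (fun s => bathInfluence B (signedTimes s)) s :=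
    ContinuousAt.comp (g := bathInfluence B)
      (hB.continuousAt_bathInfluence (signedTimes_ne_zero hs hs'))
      continuous_signedTimes.continuousAt
  have h_prod : Continuous fun s : (Fin m → ℝ) × (Fin m' → ℝ) =>
      interactionProd Hs Ws s.1 * ρ₀ * star (interactionProd Hs Ws s.2) :=
    (((continuous_interactionProd Hs Ws).comp continuous_fst).mul continuous_const).mul
      ((continuous_interactionProd Hs Ws).comp continuous_snd).star
  exact (continuousAt_const.mul h_bath).smul h_prod.continuousAt

end Kernel

/-! ### Occupation numbers -/

section Occupation

variable {ι κ : Type*} [Fintype ι] [DecidableEq κ]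

/-- The number of points `i` that `c` assigns to the cell `k`. -/
def occupation (c : ι → κ) (k : κ) : ℕ := (Finset.univ.filter fun i => c i = k).card

/-- No cell contains more than `r` points. -/
abbrev AtMost (r : ℕ) (c : ι → κ) : Prop := ∀ k, occupation c k ≤ r

theorem injective_of_atMost_one {c : ι → κ} (h : AtMost 1 c) : Function.Injective c :=
  fun i _ hij => Finset.card_le_one.1 (h (c i)) _ (by simp) _ (by simp [hij])

theorem exists_eq_on_card_of_not_atMost {r : ℕ} {c : ι → κ} (h : ¬AtMost r c) :
    ∃ i, ∃ S : Finset ι, S.card = r ∧ i ∉ S ∧ ∀ j ∈ S, c j = c i := by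
  classical
  obtain ⟨k, hk⟩ := not_forall.1 h
  obtain ⟨T, hT, hT_card⟩ := Finset.exists_subset_card_eq (Nat.succ_le_of_lt (not_le.1 hk))
  obtain ⟨i, hi⟩ : T.Nonempty := Finset.card_pos.1 (hT_card ▸ r.succ_pos)
  have hc {j : ι} (hj : j ∈ T) : c j = k := (Finset.mem_filter.1 (hT hj)).2
  refine ⟨i, T.erase i, by rw [Finset.card_erase_of_mem hi, hT_card, Nat.succ_sub_one],
    Finset.notMem_erase i T, fun j hj => ?_⟩
  rw [hc hi, hc (Finset.mem_of_mem_erase hj)]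

variable [Fintype κ]

theorem sum_occupation (c : ι → κ) : ∑ k, occupation c k = Fintype.card ι :=
  (Finset.card_eq_sum_card_fiberwise fun _ _ => Finset.mem_coe.2 (Finset.mem_univ _)).symm

/-- The indicator of the assignments that put more than `r` points into some cell. -/
def overfull (r : ℕ) (c : ι → κ) : ℝ := if AtMost r c then 0 else 1

theorem overfull_nonneg (r : ℕ) (c : ι → κ) : 0 ≤ overfull r c := by
  unfold overfull; split_ifs <;> norm_num

theorem one_le_overfull_add {ι' : Type*} [Fintype ι'] {r : ℕ} {c : ι → κ} {c' : ι' → κ}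
    (h : ¬(AtMost r c ∧ AtMost r c')) : 1 ≤ overfull r c + overfull r c' := by
  rcases not_and_or.1 h with h | h
  · have h_one : overfull r c = 1 := if_neg h
    linarith [overfull_nonneg r c']
  · have h_one : overfull r c' = 1 := if_neg h
    linarith [overfull_nonneg r c]

variable [DecidableEq ι]

theorem card_eq_on_mul_pow_le {i : ι} {S : Finset ι} (hi : i ∉ S) :
    (Finset.univ.filter fun c : ι → κ => ∀ j ∈ S, c j = c i).card * Fintype.card κ ^ S.card ≤
      Fintype.card κ ^ Fintype.card ι := by
  have h_inj : Set.InjOn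
      (fun (p : (ι → κ) × (S → κ)) j => if h : j ∈ S then p.2 ⟨j, h⟩ else p.1 j)
      ↑((Finset.univ.filter fun c : ι → κ => ∀ j ∈ S, c j = c i) ×ˢ
        (Finset.univ : Finset (S → κ))) := by
    rintro ⟨c, d⟩ hc ⟨c', d'⟩ hc' h
    simp only [Finset.coe_product, Finset.coe_filter, Finset.mem_univ, true_and, Finset.coe_univ,
      Set.mem_prod, Set.mem_ofPred_eq, Set.mem_univ, and_true] at hc hc'
    have h_off {j : ι} (hj : j ∉ S) : c j = c' j := by simpa [hj] using congrFun h j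
    have h_on : c = c' := by
      funext j
      by_cases hj : j ∈ S
      · rw [hc j hj, hc' j hj, h_off hi]
      · exact h_off hj
    have h_values : d = d' := by
      funext j
      simpa using congrFun h j
    rw [h_on, h_values]
  simpa [Finset.card_product] using
    Finset.card_le_card_of_injOn _ (fun _ _ => Finset.mem_coe.2 (Finset.mem_univ _)) h_inj

theorem card_not_atMost_mul_pow_le (r : ℕ) :
    (Finset.univ.filter fun c : ι → κ => ¬AtMost r c).card * Fintype.card κ ^ r ≤
      Fintype.card ι ^ (r + 1) * Fintype.card κ ^ Fintype.card ι := by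
  let P : Finset (ι × Finset ι) :=
    (Finset.univ ×ˢ Finset.univ.powersetCard r).filter fun p => p.1 ∉ p.2
  have h_cover : (Finset.univ.filter fun c : ι → κ => ¬AtMost r c) ⊆
      P.biUnion fun p => Finset.univ.filter fun c : ι → κ => ∀ j ∈ p.2, c j = c p.1 := by
    intro c hc
    obtain ⟨i, S, hS, hi, h⟩ := exists_eq_on_card_of_not_atMost (Finset.mem_filter.1 hc).2
    simp only [P, Finset.mem_biUnion, Finset.mem_filter, Finset.mem_product, Finset.mem_univ,
      Finset.mem_powersetCard_univ, true_and]
    exact ⟨(i, S), ⟨hS, hi⟩, h⟩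
  have h_card : P.card ≤ Fintype.card ι ^ (r + 1) :=
    calc P.card ≤ Fintype.card ι * (Fintype.card ι).choose r := by
          simpa using Finset.card_filter_le (Finset.univ ×ˢ Finset.univ.powersetCard r)
            fun p : ι × Finset ι => p.1 ∉ p.2
      _ ≤ Fintype.card ι ^ (r + 1) :=
          (Nat.mul_le_mul_left _ (Nat.choose_le_pow _ r)).trans_eq (pow_succ' _ r).symm
  calc _ ≤ (∑ p ∈ P, (Finset.univ.filter fun c : ι → κ => ∀ j ∈ p.2, c j = c p.1).card) *
          Fintype.card κ ^ r :=
        Nat.mul_le_mul_right _ ((Finset.card_le_card h_cover).trans Finset.card_biUnion_le)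
    _ ≤ ∑ _p ∈ P, Fintype.card κ ^ Fintype.card ι := by
        rw [Finset.sum_mul]
        refine Finset.sum_le_sum fun p hp => ?_
        simp only [P, Finset.mem_filter, Finset.mem_product, Finset.mem_powersetCard_univ] at hp
        simpa only [hp.1.2] using card_eq_on_mul_pow_le (κ := κ) hp.2
    _ ≤ _ := by rw [Finset.sum_const, smul_eq_mul]; gcongr

theorem sum_overfull_le (r : ℕ) :
    ∑ c : ι → κ, overfull r c ≤
      (Fintype.card ι : ℝ) ^ (r + 1) * (Fintype.card κ : ℝ) ^ Fintype.card ι /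
        (Fintype.card κ : ℝ) ^ r := by
  cases isEmpty_or_nonempty κ
  · simp only [overfull, AtMost, IsEmpty.forall_iff, if_true, Finset.sum_const_zero]
    positivity
  · have h_sum : ∑ c : ι → κ, overfull r c =
        (Finset.univ.filter fun c : ι → κ => ¬AtMost r c).card := by
      rw [Finset.card_filter, Nat.cast_sum]
      exact Finset.sum_congr rfl fun c _ => by rw [overfull, ite_not]; split_ifs <;> simp
    rw [h_sum, le_div_iff₀ (by positivity)]
    exact_mod_cast card_not_atMost_mul_pow_le r

open MvPolynomial in
theorem card_occupation_eq (j : κ → ℕ) (hj : ∑ k, j k = Fintype.card ι) :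
    (Finset.univ.filter fun c : ι → κ => occupation c = j).card =
      Nat.multinomial Finset.univ j := by
  have prod_X_pow (i : κ → ℕ) : ∏ k, (X k : MvPolynomial κ ℕ) ^ i k =
      monomial (Finsupp.equivFunOnFinite.symm i) 1 := by
    rw [monomial_eq, Finsupp.prod_fintype _ _ (by simp)]
    simp
  have prod_X_comp (c : ι → κ) : ∏ i, (X (c i) : MvPolynomial κ ℕ) =
      monomial (Finsupp.equivFunOnFinite.symm (occupation c)) 1 := by
    rw [← prod_X_pow, ← Finset.prod_fiberwise' Finset.univ c fun k => (X k : MvPolynomial κ ℕ)]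
    simp only [Finset.prod_const, occupation]
  -- Expand `(∑ k, X k) ^ card ι` over assignments and by the multinomial theorem.
  have h_expand : ∑ c : ι → κ, ∏ i, (X (c i) : MvPolynomial κ ℕ) =
      ∑ i ∈ Finset.piAntidiag Finset.univ (Fintype.card ι),
        (Nat.multinomial Finset.univ i : MvPolynomial κ ℕ) * ∏ k, X k ^ i k := by
    rw [← Finset.sum_pow_eq_sum_piAntidiag, ← Finset.card_univ (α := ι), ← Finset.prod_const,
      Finset.prod_univ_sum, Fintype.piFinset_univ]
  have h_coeff := congrArg (coeff (Finsupp.equivFunOnFinite.symm j)) h_expand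
  simp only [prod_X_comp, prod_X_pow, coeff_sum, coeff_monomial, ← nsmul_eq_mul, coeff_smul,
    EmbeddingLike.apply_eq_iff_eq] at h_coeff
  simpa [Finset.sum_ite, hj] using h_coeff

theorem sum_occupation_eq_sum_multinomial {X : Type*} [AddCommMonoid X] (φ : (κ → ℕ) → X) :
    ∑ c : ι → κ, φ (occupation c) =
      ∑ j ∈ Finset.piAntidiag Finset.univ (Fintype.card ι),
        Nat.multinomial Finset.univ j • φ j := by
  rw [← Finset.sum_fiberwise_of_maps_to (g := fun c : ι → κ => occupation c)
    (t := Finset.piAntidiag Finset.univ (Fintype.card ι)) fun c _ => by simp [sum_occupation]]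
  refine Finset.sum_congr rfl fun j hj => ?_
  rw [← card_occupation_eq (ι := ι) j (by simpa using hj), ← Finset.sum_const]
  exact Finset.sum_congr rfl fun c hc => congrArg φ (Finset.mem_filter.1 hc).2

end Occupation

section OccupationList

variable {m n : ℕ}

/-- The increasing list in which each `k` occurs `j k` times. -/
def occupationList (j : Fin n → ℕ) : List (Fin n) :=
  (List.ofFn fun k => List.replicate (j k) k).flatten

theorem count_occupationList (j : Fin n → ℕ) (k : Fin n) : (occupationList j).count k = j k := by
  simp [occupationList, List.count_flatten, List.map_ofFn, List.sum_ofFn, List.count_replicate]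

theorem sortedLE_occupationList (j : Fin n → ℕ) : (occupationList j).SortedLE := by
  rw [List.sortedLE_iff_pairwise, occupationList, List.pairwise_flatten, List.pairwise_ofFn]
  refine ⟨fun l hl => ?_, fun k k' hk x hx y hy => ?_⟩
  · obtain ⟨k, rfl⟩ := (List.mem_ofFn' _ _).1 hl
    simp [List.pairwise_replicate]
  · rw [List.eq_of_mem_replicate hx, List.eq_of_mem_replicate hy]
    exact hk.le

theorem count_ofFn_eq_occupation (c : Fin m → Fin n) (k : Fin n) :
    (List.ofFn c).count k = occupation c k := by
  rw [← Multiset.coe_count, ← Fin.univ_val_map, Multiset.count_map, occupation, Finset.card_def,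
    Finset.filter_val]
  simp only [eq_comm]

theorem occupationList_occupation (c : Fin m → Fin n) :
    occupationList (occupation c) = List.ofFn (c ∘ Tuple.sort c) := by
  have h_perm : (occupationList (occupation c)).Perm (List.ofFn c) :=
    List.perm_iff_count.2 fun k => by rw [count_occupationList, count_ofFn_eq_occupation]
  exact (h_perm.trans (Equiv.Perm.ofFn_comp_perm _ c).symm).eq_of_sortedLE
    (sortedLE_occupationList _) (List.sortedLE_ofFn_iff.2 (Tuple.monotone_sort c))

end OccupationList

/-! ### Integrals over products of almost everywhere partitioned sets -/

section Partition

variable {α β X ι κ : Type*} [MeasurableSpace α] [MeasurableSpace β] {μ : Measure α}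
  {ν : Measure β} [NormedAddCommGroup X] {s : Set α} {t : Set β}
  {A : ι → Set α} {A' : κ → Set β} {F : α × β → X}

theorem iUnion_prod_ae_eq (hs : (⋃ i, A i) =ᵐ[μ] s) (ht : (⋃ k, A' k) =ᵐ[ν] t) :
    (⋃ p : ι × κ, A p.1 ×ˢ A' p.2) =ᵐ[μ.prod ν] s ×ˢ t := by
  rw [Set.iUnion_prod]
  exact Measure.set_prod_ae_eq hs ht

theorem integrableOn_prod_of_partition [Finite ι] [Finite κ]
    (hs : (⋃ i, A i) =ᵐ[μ] s) (ht : (⋃ k, A' k) =ᵐ[ν] t)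
    (hF : ∀ i k, IntegrableOn F (A i ×ˢ A' k) (μ.prod ν)) :
    IntegrableOn F (s ×ˢ t) (μ.prod ν) :=
  (integrableOn_finite_iUnion.2 fun p : ι × κ => hF p.1 p.2).congr_set_ae
    (iUnion_prod_ae_eq hs ht).symm

theorem setIntegral_prod_eq_sum_of_partition [Fintype ι] [Fintype κ] [NormedSpace ℝ X]
    (hA : ∀ i, MeasurableSet (A i)) (hA' : ∀ k, MeasurableSet (A' k))
    (hd : Pairwise (Function.onFun Disjoint A)) (hd' : Pairwise (Function.onFun Disjoint A'))
    (hs : (⋃ i, A i) =ᵐ[μ] s) (ht : (⋃ k, A' k) =ᵐ[ν] t)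
    (hF : ∀ i k, IntegrableOn F (A i ×ˢ A' k) (μ.prod ν)) :
    ∫ x in s ×ˢ t, F x ∂μ.prod ν = ∑ i, ∑ k, ∫ x in A i ×ˢ A' k, F x ∂μ.prod ν := by
  have h_disjoint : Pairwise (Function.onFun Disjoint fun p : ι × κ => A p.1 ×ˢ A' p.2) := by
    rintro ⟨i, k⟩ ⟨i', k'⟩ hne
    rw [Function.onFun, Set.disjoint_prod]
    by_cases h : i = i'
    · exact Or.inr (hd' fun hk => hne (Prod.ext h hk))
    · exact Or.inl (hd h)
  rw [← setIntegral_congr_set (iUnion_prod_ae_eq hs ht),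
    integral_iUnion_fintype (s := fun p : ι × κ => A p.1 ×ˢ A' p.2)
      (fun p => (hA p.1).prod (hA' p.2)) h_disjoint fun p => hF p.1 p.2,
    Fintype.sum_prod_type]

end Partition

/-! ### Symmetrization over the cube -/

section Chambers

variable {m m' : ℕ} {T : ℝ}

/-- The cube `(0, T)^m`. -/
def cube (m : ℕ) (T : ℝ) : Set (Fin m → ℝ) := Set.univ.pi fun _ => Set.Ioo 0 T

theorem mem_cube {τ : Fin m → ℝ} : τ ∈ cube m T ↔ ∀ i, 0 < τ i ∧ τ i < T := by
  simp only [cube, Set.mem_univ_pi, Set.mem_Ioo]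

theorem ae_injective (ι : Type*) [Fintype ι] : ∀ᵐ τ : ι → ℝ, Function.Injective τ := by
  classical
  have ae_ne (i j : ι) (hij : i ≠ j) : ∀ᵐ τ : ι → ℝ, τ i ≠ τ j := by
    let diagonal := LinearMap.ker ((LinearMap.proj i : (ι → ℝ) →ₗ[ℝ] ℝ) - LinearMap.proj j)
    have h_proper : diagonal ≠ ⊤ := by
      rw [Ne, LinearMap.ker_eq_top]
      intro h
      simpa [hij.symm] using LinearMap.congr_fun h (Pi.single i 1)
    have h_null : ∀ᵐ τ : ι → ℝ, τ ∉ (diagonal : Set (ι → ℝ)) :=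
      measure_eq_zero_iff_ae_notMem.1 (Measure.addHaar_submodule volume _ h_proper)
    filter_upwards [h_null] with τ hτ h
    exact hτ (by simp [diagonal, h])
  have h_all : ∀ᵐ τ : ι → ℝ, ∀ i j, i ≠ j → τ i ≠ τ j := by simpa only [ae_all_iff] using ae_ne
  filter_upwards [h_all] with τ hτ i j
  exact not_imp_not.1 (hτ i j)

theorem measurableSet_simplex (m : ℕ) (T : ℝ) : MeasurableSet (simplex m T) := by
  have h_eq : simplex m T =
      (⋂ i, ⋂ j, {s | i < j → s i < s j}) ∩ ⋂ i, {s | 0 < s i ∧ s i < T} := by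
    ext s
    simp [simplex, StrictMono]
  rw [h_eq]
  refine (MeasurableSet.iInter fun i => .iInter fun j => ?_).inter (.iInter fun i => ?_)
  · by_cases h : i < j
    · simpa [h] using measurableSet_lt (measurable_pi_apply i) (measurable_pi_apply j)
    · simp [h]
  · exact (measurableSet_lt measurable_const (measurable_pi_apply i)).inter
      (measurableSet_lt (measurable_pi_apply i) measurable_const)

/-- The permutation `τ ↦ τ ∘ π` of coordinates as a measurable equivalence. -/
def permEquiv (π : Equiv.Perm (Fin m)) : (Fin m → ℝ) ≃ᵐ (Fin m → ℝ) :=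
  MeasurableEquiv.piCongrLeft (fun _ => ℝ) π.symm

theorem permEquiv_apply (π : Equiv.Perm (Fin m)) (τ : Fin m → ℝ) : permEquiv π τ = τ ∘ π := by
  funext i
  simpa [permEquiv, MeasurableEquiv.coe_piCongrLeft] using
    Equiv.piCongrLeft_apply_apply (fun _ => ℝ) π.symm τ (π i)

theorem measurePreserving_permEquiv (π : Equiv.Perm (Fin m)) : MeasurePreserving (permEquiv π) :=
  volume_measurePreserving_piCongrLeft (fun _ => ℝ) π.symm

/-- The chamber of the cube `(0, T)^m` on which `τ ∘ π` is increasing. -/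
def chamber (T : ℝ) (π : Equiv.Perm (Fin m)) : Set (Fin m → ℝ) := permEquiv π ⁻¹' simplex m T

theorem mem_chamber {π : Equiv.Perm (Fin m)} {τ : Fin m → ℝ} :
    τ ∈ chamber T π ↔ τ ∘ π ∈ simplex m T := by
  rw [chamber, Set.mem_preimage, permEquiv_apply]

theorem measurableSet_chamber (T : ℝ) (π : Equiv.Perm (Fin m)) : MeasurableSet (chamber T π) :=
  (permEquiv π).measurable (measurableSet_simplex m T)

theorem sort_eq_of_strictMono {α : Type*} [LinearOrder α] {τ : Fin m → α} {π : Equiv.Perm (Fin m)}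
    (h : StrictMono (τ ∘ π)) : Tuple.sort τ = π :=
  (Tuple.eq_sort_iff.2 ⟨h.monotone, fun _ _ hij he => absurd he (h hij).ne⟩).symm

theorem sort_eq_of_mem_chamber {π : Equiv.Perm (Fin m)} {τ : Fin m → ℝ} (h : τ ∈ chamber T π) :
    Tuple.sort τ = π :=
  sort_eq_of_strictMono (mem_chamber.1 h).1

theorem pairwise_disjoint_chamber (m : ℕ) (T : ℝ) :
    Pairwise (Function.onFun Disjoint (chamber (m := m) T)) := fun _ _ hne =>
  Set.disjoint_left.2 fun _ h h' =>
    hne ((sort_eq_of_mem_chamber h).symm.trans (sort_eq_of_mem_chamber h'))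

theorem iUnion_chamber_ae_eq (m : ℕ) (T : ℝ) :
    (⋃ π, chamber (m := m) T π) =ᵐ[volume] cube m T := by
  rw [Filter.eventuallyEq_set]
  filter_upwards [ae_injective (Fin m)] with τ hτ
  simp only [Set.mem_iUnion, mem_chamber, mem_cube]
  constructor
  · rintro ⟨π, -, h⟩ i
    simpa using h (π.symm i)
  · exact fun h => ⟨Tuple.sort τ, (Tuple.monotone_sort τ).strictMono_of_injective
      (hτ.comp (Tuple.sort τ).injective), fun i => h _⟩

variable {X : Type*}

/-- The function on the cubes that agrees with `f` on increasing tuples and does not depend on the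
order of the coordinates. -/
def symmetrize (f : (Fin m → ℝ) × (Fin m' → ℝ) → X) (s : (Fin m → ℝ) × (Fin m' → ℝ)) : X :=
  f (s.1 ∘ Tuple.sort s.1, s.2 ∘ Tuple.sort s.2)

/-- Independent permutations of the two groups of coordinates. -/
def permEquivProd (π : Equiv.Perm (Fin m)) (π' : Equiv.Perm (Fin m')) :
    (Fin m → ℝ) × (Fin m' → ℝ) ≃ᵐ (Fin m → ℝ) × (Fin m' → ℝ) :=
  (permEquiv π).prodCongr (permEquiv π')

theorem measurePreserving_permEquivProd (π : Equiv.Perm (Fin m)) (π' : Equiv.Perm (Fin m')) :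
    MeasurePreserving (permEquivProd π π') :=
  (measurePreserving_permEquiv π).prod (measurePreserving_permEquiv π')

theorem preimage_permEquivProd (T : ℝ) (π : Equiv.Perm (Fin m)) (π' : Equiv.Perm (Fin m')) :
    permEquivProd π π' ⁻¹' (simplex m T ×ˢ simplex m' T) = chamber T π ×ˢ chamber T π' := rfl

theorem eqOn_symmetrize_chamber (f : (Fin m → ℝ) × (Fin m' → ℝ) → X) (π : Equiv.Perm (Fin m))
    (π' : Equiv.Perm (Fin m')) :
    Set.EqOn (f ∘ permEquivProd π π') (symmetrize f) (chamber T π ×ˢ chamber T π') := by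
  rintro ⟨τ, τ'⟩ ⟨h, h'⟩
  have h_apply : permEquivProd π π' (τ, τ') = (τ ∘ π, τ' ∘ π') :=
    Prod.ext (permEquiv_apply π τ) (permEquiv_apply π' τ')
  simp only [symmetrize, sort_eq_of_mem_chamber h, sort_eq_of_mem_chamber h', Function.comp_apply,
    h_apply]

variable [NormedAddCommGroup X] {f : (Fin m → ℝ) × (Fin m' → ℝ) → X}

theorem integrableOn_symmetrize_chamber (hf : IntegrableOn f (simplex m T ×ˢ simplex m' T))
    (π : Equiv.Perm (Fin m)) (π' : Equiv.Perm (Fin m')) :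
    IntegrableOn (symmetrize f) (chamber T π ×ˢ chamber T π') := by
  refine IntegrableOn.congr_fun ?_ (eqOn_symmetrize_chamber f π π')
    ((measurableSet_chamber T π).prod (measurableSet_chamber T π'))
  rw [← preimage_permEquivProd]
  exact ((measurePreserving_permEquivProd π π').integrableOn_comp_preimage
    (permEquivProd π π').measurableEmbedding).2 hf

theorem integrableOn_symmetrize (hf : IntegrableOn f (simplex m T ×ˢ simplex m' T)) :
    IntegrableOn (symmetrize f) (cube m T ×ˢ cube m' T) :=
  integrableOn_prod_of_partition (iUnion_chamber_ae_eq m T) (iUnion_chamber_ae_eq m' T)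
    (integrableOn_symmetrize_chamber hf)

variable [NormedSpace ℝ X]

theorem setIntegral_symmetrize_chamber (f : (Fin m → ℝ) × (Fin m' → ℝ) → X)
    (π : Equiv.Perm (Fin m)) (π' : Equiv.Perm (Fin m')) :
    ∫ s in chamber T π ×ˢ chamber T π', symmetrize f s =
      ∫ s in simplex m T ×ˢ simplex m' T, f s := by
  rw [← setIntegral_congr_fun ((measurableSet_chamber T π).prod (measurableSet_chamber T π'))
    (eqOn_symmetrize_chamber f π π'), ← preimage_permEquivProd]
  exact (measurePreserving_permEquivProd π π').setIntegral_preimage_emb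
    (permEquivProd π π').measurableEmbedding f _

theorem setIntegral_symmetrize (hf : IntegrableOn f (simplex m T ×ˢ simplex m' T)) :
    ∫ s in cube m T ×ˢ cube m' T, symmetrize f s =
      (m.factorial * m'.factorial : ℝ) • ∫ s in simplex m T ×ˢ simplex m' T, f s :=
  calc _ = ∑ π, ∑ π', ∫ s in chamber T π ×ˢ chamber T π', symmetrize f s :=
        setIntegral_prod_eq_sum_of_partition (measurableSet_chamber T) (measurableSet_chamber T)
          (pairwise_disjoint_chamber m T) (pairwise_disjoint_chamber m' T)
          (iUnion_chamber_ae_eq m T) (iUnion_chamber_ae_eq m' T)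
          (integrableOn_symmetrize_chamber hf)
    _ = _ := by
        simp only [setIntegral_symmetrize_chamber, Finset.sum_const, Finset.card_univ,
          Fintype.card_perm, Fintype.card_fin, ← Nat.cast_smul_eq_nsmul ℝ, smul_smul]

end Chambers

/-! ### Cells -/

section Box

variable {m m' n : ℕ} {δ : ℝ}

/-- The product of the open cells `(c_i δ, (c_i + 1) δ)`. -/
def box (δ : ℝ) (c : Fin m → Fin n) : Set (Fin m → ℝ) :=
  Set.univ.pi fun i => Set.Ioo ((c i : ℕ) * δ) (((c i : ℕ) + 1) * δ)

theorem mem_box {c : Fin m → Fin n} {τ : Fin m → ℝ} :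
    τ ∈ box δ c ↔ ∀ i, (c i : ℕ) * δ < τ i ∧ τ i < ((c i : ℕ) + 1) * δ := by
  simp only [box, Set.mem_univ_pi, Set.mem_Ioo]

theorem measurableSet_box (δ : ℝ) (c : Fin m → Fin n) : MeasurableSet (box δ c) :=
  .univ_pi fun _ => measurableSet_Ioo

theorem lt_of_mem_box_of_lt (hδ : 0 ≤ δ) {c c' : Fin m → Fin n} {τ τ' : Fin m → ℝ}
    (h : τ ∈ box δ c) (h' : τ' ∈ box δ c') {i j : Fin m} (hij : c i < c' j) : τ i < τ' j :=
  calc τ i < ((c i : ℕ) + 1) * δ := (mem_box.1 h i).2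
    _ ≤ (c' j : ℕ) * δ := by gcongr; exact_mod_cast hij
    _ < τ' j := (mem_box.1 h' j).1

theorem pairwise_disjoint_box (hδ : 0 ≤ δ) :
    Pairwise (Function.onFun Disjoint (box (m := m) (n := n) δ)) := by
  refine fun c c' hne => Set.disjoint_left.2 fun τ h h' => hne (funext fun i => ?_)
  rcases lt_trichotomy (c i) (c' i) with hlt | heq | hlt
  · exact absurd (lt_of_mem_box_of_lt hδ h h' hlt) (lt_irrefl _)
  · exact heq
  · exact absurd (lt_of_mem_box_of_lt hδ h' h hlt) (lt_irrefl _)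

theorem box_subset_cube (hδ : 0 ≤ δ) (c : Fin m → Fin n) : box δ c ⊆ cube m (n * δ) := by
  refine fun τ h => mem_cube.2 fun i => ?_
  obtain ⟨h_lo, h_hi⟩ := mem_box.1 h i
  refine ⟨lt_of_le_of_lt (by positivity) h_lo, h_hi.trans_le ?_⟩
  gcongr
  exact_mod_cast (c i).2

theorem exists_mem_box (hδ : 0 < δ) {τ : Fin m → ℝ} (hτ : τ ∈ cube m (n * δ))
    (h_ne : ∀ (i : Fin m) (k : ℕ), τ i ≠ k * δ) : ∃ c : Fin m → Fin n, τ ∈ box δ c := by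
  have h_nonneg (i : Fin m) : 0 ≤ τ i / δ := div_nonneg (mem_cube.1 hτ i).1.le hδ.le
  have h_floor (i : Fin m) : ⌊τ i / δ⌋₊ < n :=
    (Nat.floor_lt (h_nonneg i)).2 ((div_lt_iff₀ hδ).2 (mem_cube.1 hτ i).2)
  refine ⟨fun i => ⟨⌊τ i / δ⌋₊, h_floor i⟩, mem_box.2 fun i => ⟨?_, ?_⟩⟩
  · exact lt_of_le_of_ne ((le_div_iff₀ hδ).1 (Nat.floor_le (h_nonneg i))) (h_ne i _).symm
  · exact (div_lt_iff₀ hδ).1 (Nat.lt_floor_add_one _)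

theorem iUnion_box_ae_eq (m n : ℕ) (hδ : 0 < δ) :
    (⋃ c : Fin m → Fin n, box δ c) =ᵐ[volume] cube m (n * δ) := by
  have h_ne : ∀ᵐ τ : Fin m → ℝ, ∀ (i : Fin m) (k : ℕ), τ i ≠ k * δ := by
    simp only [ae_all_iff]
    exact fun i k => Measure.ae_eval_ne (fun _ : Fin m => (volume : Measure ℝ)) i _
  rw [Filter.eventuallyEq_set]
  filter_upwards [h_ne] with τ hτ
  rw [Set.mem_iUnion]
  exact ⟨fun ⟨c, hc⟩ => box_subset_cube hδ.le c hc, fun h => exists_mem_box hδ h hτ⟩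

theorem volume_real_box (hδ : 0 ≤ δ) (c : Fin m → Fin n) : volume.real (box δ c) = δ ^ m := by
  have h_le : (fun i => ((c i : ℕ) : ℝ) * δ) ≤ fun i => ((c i : ℕ) + 1) * δ := fun i => by
    change ((c i : ℕ) : ℝ) * δ ≤ ((c i : ℕ) + 1) * δ
    linarith
  rw [Measure.real, box, Real.volume_pi_Ioo_toReal h_le]
  simp [add_mul]

theorem volume_real_box_prod (hδ : 0 ≤ δ) (c : Fin m → Fin n) (c' : Fin m' → Fin n) :
    volume.real (box δ c ×ˢ box δ c') = δ ^ (m + m') := by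
  rw [Measure.volume_eq_prod, measureReal_prod_prod, volume_real_box hδ, volume_real_box hδ,
    pow_add]

theorem volume_box_prod_lt_top (c : Fin m → Fin n) (c' : Fin m' → Fin n) :
    volume (box δ c ×ˢ box δ c') < ⊤ := by
  rw [Measure.volume_eq_prod, Measure.prod_prod, box, box, Real.volume_pi_Ioo, Real.volume_pi_Ioo]
  exact ENNReal.mul_lt_top (ENNReal.prod_lt_top fun _ _ => ENNReal.ofReal_lt_top)
    (ENNReal.prod_lt_top fun _ _ => ENNReal.ofReal_lt_top)

end Box

/-! ### The midpoint rule on a cell -/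

section CellMid

variable {m n : ℕ} {δ : ℝ} {c : Fin m → Fin n} {τ : Fin m → ℝ}

/-- The centre of `box δ c`. -/
def cellMid (δ : ℝ) (c : Fin m → Fin n) (i : Fin m) : ℝ := ((c i : ℕ) + 1 / 2) * δ

/-- The reflection of the space of times in the centre of `box δ c`. -/
def cellReflection (δ : ℝ) (c : Fin m → Fin n) : (Fin m → ℝ) ≃ᵐ (Fin m → ℝ) :=
  MeasurableEquiv.subLeft ((2 : ℝ) • cellMid δ c)

theorem cellReflection_apply (δ : ℝ) (c : Fin m → Fin n) (τ : Fin m → ℝ) (i : Fin m) :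
    cellReflection δ c τ i = 2 * cellMid δ c i - τ i := rfl

theorem measurePreserving_cellReflection (δ : ℝ) (c : Fin m → Fin n) :
    MeasurePreserving (cellReflection δ c) :=
  Measure.measurePreserving_sub_left volume _

theorem cellReflection_mem_box_iff : cellReflection δ c τ ∈ box δ c ↔ τ ∈ box δ c := by
  simp only [mem_box, cellReflection_apply, cellMid]
  refine forall_congr' fun i => ?_
  constructor <;> rintro ⟨h_lo, h_hi⟩ <;> constructor <;> linarith

theorem reflects_cellMid (hδ : 0 ≤ δ) (h : τ ∈ box δ c) :
    Reflects δ (cellMid δ c) τ (cellReflection δ c τ) := by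
  intro i
  obtain ⟨h_lo, h_hi⟩ := mem_box.1 h i
  have h_nonneg : 0 ≤ ((c i : ℕ) : ℝ) * δ := by positivity
  have h_dist : |τ i - cellMid δ c i| < δ / 2 := by
    rw [abs_lt, cellMid]
    constructor <;> linarith
  have h_far : δ / 2 ≤ |cellMid δ c i| := by
    rw [cellMid]
    exact le_trans (by linarith) (le_abs_self _)
  exact ⟨by linarith, by linarith, cellReflection_apply δ c τ i⟩

theorem comp_sort_eq_of_mem_box (hδ : 0 ≤ δ) (h : τ ∈ box δ c) :
    c ∘ Tuple.sort τ = c ∘ Tuple.sort c := by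
  refine Tuple.unique_monotone (fun i j hij => ?_) (Tuple.monotone_sort c)
  by_contra hlt
  exact absurd (lt_of_mem_box_of_lt hδ h h (not_le.1 hlt)) (not_lt.2 (Tuple.monotone_sort τ hij))

theorem sort_eq_of_mem_box (hδ : 0 ≤ δ) (hc : Function.Injective c) (h : τ ∈ box δ c) :
    Tuple.sort τ = Tuple.sort c :=
  Equiv.ext fun i => hc (congrFun (comp_sort_eq_of_mem_box hδ h) i)

theorem reflects_comp_sort (hδ : 0 ≤ δ) (h : τ ∈ box δ c) :
    Reflects δ (cellMid δ (c ∘ Tuple.sort c)) (τ ∘ Tuple.sort τ)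
      (cellReflection δ c τ ∘ Tuple.sort τ) := by
  rw [← comp_sort_eq_of_mem_box hδ h]
  exact (reflects_cellMid hδ h).comp _

end CellMid

section CellError

variable {X : Type*} {m m' n : ℕ} {δ M d : ℝ} {f : (Fin m → ℝ) × (Fin m' → ℝ) → X}
  {c : Fin m → Fin n} {c' : Fin m' → Fin n}

/-- The value of `f` at the centre of the cell `box δ c ×ˢ box δ c'`, with both groups of times
arranged in increasing order by sorting the cell indices. -/
def cellValue (f : (Fin m → ℝ) × (Fin m' → ℝ) → X) (δ : ℝ) (c : Fin m → Fin n)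
    (c' : Fin m' → Fin n) : X :=
  f (cellMid δ (c ∘ Tuple.sort c), cellMid δ (c' ∘ Tuple.sort c'))

/-- The reflection of both groups of times in the centre of their cell. -/
def cellReflectionProd (δ : ℝ) (c : Fin m → Fin n) (c' : Fin m' → Fin n) :
    (Fin m → ℝ) × (Fin m' → ℝ) ≃ᵐ (Fin m → ℝ) × (Fin m' → ℝ) :=
  (cellReflection δ c).prodCongr (cellReflection δ c')

theorem measurePreserving_cellReflectionProd (δ : ℝ) (c : Fin m → Fin n) (c' : Fin m' → Fin n) :
    MeasurePreserving (cellReflectionProd δ c c') :=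
  (measurePreserving_cellReflection δ c).prod (measurePreserving_cellReflection δ c')

theorem preimage_cellReflectionProd (δ : ℝ) (c : Fin m → Fin n) (c' : Fin m' → Fin n) :
    cellReflectionProd δ c c' ⁻¹' (box δ c ×ˢ box δ c') = box δ c ×ˢ box δ c' :=
  Set.ext fun _ => and_congr cellReflection_mem_box_iff cellReflection_mem_box_iff

variable [NormedAddCommGroup X]

theorem HasSecondDiffBound.nonneg (hf : HasSecondDiffBound f δ M d) (hδ : 0 ≤ δ) : 0 ≤ M := by
  have h_refl (k : ℕ) : Reflects δ (1 : Fin k → ℝ) 1 1 := fun _ => by norm_num [hδ]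
  exact (hf (h_refl m) (h_refl m')).nonneg

theorem HasSecondDiffBound.symmetrize_cell (hf : HasSecondDiffBound f δ M d) (hδ : 0 ≤ δ)
    (hc : Function.Injective c) (hc' : Function.Injective c') {s : (Fin m → ℝ) × (Fin m' → ℝ)}
    (hs : s ∈ box δ c ×ˢ box δ c') :
    SecondDiffBound (cellValue f δ c c') (symmetrize f s)
      (symmetrize f (cellReflectionProd δ c c' s)) M d := by
  have h := hf (reflects_comp_sort hδ hs.1) (reflects_comp_sort hδ hs.2)
  rw [sort_eq_of_mem_box hδ hc hs.1, sort_eq_of_mem_box hδ hc' hs.2] at h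
  have h_sort := sort_eq_of_mem_box hδ hc (cellReflection_mem_box_iff.2 hs.1)
  have h_sort' := sort_eq_of_mem_box hδ hc' (cellReflection_mem_box_iff.2 hs.2)
  have h_refl : symmetrize f (cellReflectionProd δ c c' s) =
      f (cellReflection δ c s.1 ∘ Tuple.sort c, cellReflection δ c' s.2 ∘ Tuple.sort c') := by
    rw [← h_sort, ← h_sort']
    rfl
  rw [symmetrize, sort_eq_of_mem_box hδ hc hs.1, sort_eq_of_mem_box hδ hc' hs.2, h_refl]
  exact h

theorem integrableOn_comp_cellReflectionProd {F : (Fin m → ℝ) × (Fin m' → ℝ) → X}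
    (hF : IntegrableOn F (box δ c ×ˢ box δ c')) :
    IntegrableOn (F ∘ cellReflectionProd δ c c') (box δ c ×ˢ box δ c') := by
  rw [← preimage_cellReflectionProd δ c c']
  exact ((measurePreserving_cellReflectionProd δ c c').integrableOn_comp_preimage
    (cellReflectionProd δ c c').measurableEmbedding).2 hF

variable [NormedSpace ℝ X]

theorem setIntegral_comp_cellReflectionProd (F : (Fin m → ℝ) × (Fin m' → ℝ) → X) :
    ∫ s in box δ c ×ˢ box δ c', F (cellReflectionProd δ c c' s) =
      ∫ s in box δ c ×ˢ box δ c', F s := by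
  conv_lhs => rw [← preimage_cellReflectionProd δ c c']
  exact (measurePreserving_cellReflectionProd δ c c').setIntegral_preimage_emb
    (cellReflectionProd δ c c').measurableEmbedding F _

theorem norm_setIntegral_box_prod_le (hδ : 0 ≤ δ) {F : (Fin m → ℝ) × (Fin m' → ℝ) → X} {C : ℝ}
    (hF : ∀ s ∈ box δ c ×ˢ box δ c', ‖F s‖ ≤ C) :
    ‖∫ s in box δ c ×ˢ box δ c', F s‖ ≤ δ ^ (m + m') * C := by
  rw [← volume_real_box_prod hδ c c', mul_comm]
  exact norm_setIntegral_le_of_norm_le_const (volume_box_prod_lt_top c c') hF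

theorem norm_setIntegral_symmetrize_box_le (hδ : 0 ≤ δ) (hf : HasSecondDiffBound f δ M d)
    (c : Fin m → Fin n) (c' : Fin m' → Fin n) :
    ‖∫ s in box δ c ×ˢ box δ c', symmetrize f s‖ ≤ δ ^ (m + m') * M :=
  norm_setIntegral_box_prod_le hδ fun _ hs =>
    (hf (reflects_comp_sort hδ hs.1) (reflects_comp_sort hδ hs.2)).norm_fst

variable [CompleteSpace X]

theorem setIntegral_box_prod_const (hδ : 0 ≤ δ) (c : Fin m → Fin n) (c' : Fin m' → Fin n) (x : X) :
    ∫ _ in box δ c ×ˢ box δ c', x = δ ^ (m + m') • x := by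
  rw [setIntegral_const, volume_real_box_prod hδ]

theorem norm_setIntegral_symmetrize_box_sub_le (hδ : 0 ≤ δ) (hf : HasSecondDiffBound f δ M d)
    (hint : IntegrableOn (symmetrize f) (box δ c ×ˢ box δ c')) :
    ‖(∫ s in box δ c ×ˢ box δ c', symmetrize f s) - δ ^ (m + m') • cellValue f δ c c'‖ ≤
      δ ^ (m + m') * (M * d) := by
  rw [← setIntegral_box_prod_const hδ c c', ← integral_sub hint
    (integrableOn_const (volume_box_prod_lt_top c c').ne)]
  exact norm_setIntegral_box_prod_le hδ fun s hs =>
    (hf (reflects_comp_sort hδ hs.1) (reflects_comp_sort hδ hs.2)).diff_fst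

-- Averaging the integrand with its reflection in the centre of the cell cancels the first order.
theorem two_smul_setIntegral_box_sub (hδ : 0 ≤ δ) {F : (Fin m → ℝ) × (Fin m' → ℝ) → X}
    (hF : IntegrableOn F (box δ c ×ˢ box δ c')) (x : X) :
    (2 : ℝ) • ((∫ s in box δ c ×ˢ box δ c', F s) - δ ^ (m + m') • x) =
      ∫ s in box δ c ×ˢ box δ c', (F s + F (cellReflectionProd δ c c' s) - (x + x)) := by
  have hF' : IntegrableOn (fun s => F (cellReflectionProd δ c c' s)) (box δ c ×ˢ box δ c') :=
    integrableOn_comp_cellReflectionProd hF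
  have h_add : IntegrableOn (fun s => F s + F (cellReflectionProd δ c c' s))
      (box δ c ×ˢ box δ c') := hF.add hF'
  rw [integral_sub h_add (integrableOn_const (volume_box_prod_lt_top c c').ne),
    integral_add hF hF', setIntegral_comp_cellReflectionProd, setIntegral_box_prod_const hδ]
  module

theorem norm_setIntegral_symmetrize_box_sub_le_of_injective (hδ : 0 ≤ δ)
    (hf : HasSecondDiffBound f δ M d) (hc : Function.Injective c) (hc' : Function.Injective c')
    (hint : IntegrableOn (symmetrize f) (box δ c ×ˢ box δ c')) :
    ‖(∫ s in box δ c ×ˢ box δ c', symmetrize f s) - δ ^ (m + m') • cellValue f δ c c'‖ ≤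
      δ ^ (m + m') * (M * d ^ 2) := by
  set error := (∫ s in box δ c ×ˢ box δ c', symmetrize f s) - δ ^ (m + m') • cellValue f δ c c'
    with h_error
  have h_bound : ‖(2 : ℝ) • error‖ ≤ δ ^ (m + m') * (M * d ^ 2) := by
    rw [h_error, two_smul_setIntegral_box_sub hδ hint]
    exact norm_setIntegral_box_prod_le hδ fun s hs =>
      (hf.symmetrize_cell hδ hc hc' hs).second_diff
  rw [norm_smul, Real.norm_ofNat] at h_bound
  linarith [norm_nonneg error]

/-- The contribution of the cell `box δ c ×ˢ box δ c'` to the midpoint rule; cells with three equal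
coordinates are discarded, because a step of the scheme carries at most two interactions. -/
def cellContribution (f : (Fin m → ℝ) × (Fin m' → ℝ) → X) (δ : ℝ) (c : Fin m → Fin n)
    (c' : Fin m' → Fin n) : X :=
  if AtMost 2 c ∧ AtMost 2 c' then δ ^ (m + m') • cellValue f δ c c' else 0

theorem norm_setIntegral_symmetrize_box_sub_cellContribution_le (hδ : 0 ≤ δ) (hd : 0 ≤ d)
    (hf : HasSecondDiffBound f δ M d)
    (hint : IntegrableOn (symmetrize f) (box δ c ×ˢ box δ c')) :
    ‖(∫ s in box δ c ×ˢ box δ c', symmetrize f s) - cellContribution f δ c c'‖ ≤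
      δ ^ (m + m') * M *
        (d ^ 2 + d * (overfull 1 c + overfull 1 c') + (overfull 2 c + overfull 2 c')) := by
  have hM : 0 ≤ δ ^ (m + m') * M := mul_nonneg (pow_nonneg hδ _) (hf.nonneg hδ)
  have h_pair : 0 ≤ overfull 1 c + overfull 1 c' :=
    add_nonneg (overfull_nonneg 1 c) (overfull_nonneg 1 c')
  have h_triple : 0 ≤ overfull 2 c + overfull 2 c' :=
    add_nonneg (overfull_nonneg 2 c) (overfull_nonneg 2 c')
  rw [cellContribution]
  split_ifs with h₂
  · by_cases h₁ : AtMost 1 c ∧ AtMost 1 c'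
    · refine (norm_setIntegral_symmetrize_box_sub_le_of_injective hδ hf
        (injective_of_atMost_one h₁.1) (injective_of_atMost_one h₁.2) hint).trans ?_
      rw [← mul_assoc]
      refine mul_le_mul_of_nonneg_left ?_ hM
      linarith [mul_nonneg hd h_pair]
    · refine (norm_setIntegral_symmetrize_box_sub_le hδ hf hint).trans ?_
      rw [← mul_assoc]
      refine mul_le_mul_of_nonneg_left ?_ hM
      linarith [le_mul_of_one_le_right hd (one_le_overfull_add h₁), sq_nonneg d]
  · rw [sub_zero]
    refine (norm_setIntegral_symmetrize_box_le hδ hf c c').trans (le_mul_of_one_le_right hM ?_)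
    linarith [one_le_overfull_add h₂, mul_nonneg hd h_pair, sq_nonneg d]

end CellError

/-! ### The midpoint rule on the simplices -/

section MidpointSum

theorem sum_sum_add {α β : Type*} [Fintype α] [Fintype β] (u : α → ℝ) (v : β → ℝ) :
    ∑ a, ∑ b, (u a + v b) = Fintype.card β * ∑ a, u a + Fintype.card α * ∑ b, v b := by
  simp [Finset.sum_add_distrib, Finset.mul_sum]

variable {X : Type*} [NormedAddCommGroup X] [NormedSpace ℝ X] {m m' n : ℕ} {δ M d : ℝ}
  {f : (Fin m → ℝ) × (Fin m' → ℝ) → X}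

theorem sum_sum_overfull_le (m m' n r : ℕ) :
    ∑ c : Fin m → Fin n, ∑ c' : Fin m' → Fin n, (overfull r c + overfull r c') ≤
      (n : ℝ) ^ (m + m') * ((m ^ (r + 1) + m' ^ (r + 1)) / n ^ r) := by
  have h_card (k : ℕ) : (Fintype.card (Fin k → Fin n) : ℝ) = (n : ℝ) ^ k := by simp
  have h_sum (k : ℕ) : ∑ c : Fin k → Fin n, overfull r c ≤ (k : ℝ) ^ (r + 1) * n ^ k / n ^ r := by
    simpa only [Fintype.card_fin] using sum_overfull_le (ι := Fin k) (κ := Fin n) r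
  calc _ = (n : ℝ) ^ m' * ∑ c : Fin m → Fin n, overfull r c +
        (n : ℝ) ^ m * ∑ c' : Fin m' → Fin n, overfull r c' := by
        rw [sum_sum_add, h_card, h_card]
    _ ≤ (n : ℝ) ^ m' * ((m : ℝ) ^ (r + 1) * n ^ m / n ^ r) +
        (n : ℝ) ^ m * ((m' : ℝ) ^ (r + 1) * n ^ m' / n ^ r) := by
        gcongr <;> exact h_sum _
    _ = _ := by rw [pow_add (n : ℝ)]; ring

theorem sum_sum_cell_bound_le (m m' n : ℕ) (hd : 0 ≤ d) :
    ∑ c : Fin m → Fin n, ∑ c' : Fin m' → Fin n,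
        (d ^ 2 + d * (overfull 1 c + overfull 1 c') + (overfull 2 c + overfull 2 c')) ≤
      (n : ℝ) ^ (m + m') *
        (d ^ 2 + d * (m ^ 2 + m' ^ 2) / n + (m ^ 3 + m' ^ 3) / n ^ 2) := by
  have h_const : ∑ _c : Fin m → Fin n, ∑ _c' : Fin m' → Fin n, d ^ 2 =
      (n : ℝ) ^ (m + m') * d ^ 2 := by
    simp [pow_add, mul_assoc]
  calc _ = (n : ℝ) ^ (m + m') * d ^ 2 +
        d * ∑ c : Fin m → Fin n, ∑ c' : Fin m' → Fin n, (overfull 1 c + overfull 1 c') +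
        ∑ c : Fin m → Fin n, ∑ c' : Fin m' → Fin n, (overfull 2 c + overfull 2 c') := by
        rw [← h_const]
        simp only [Finset.mul_sum, ← Finset.sum_add_distrib]
    _ ≤ (n : ℝ) ^ (m + m') * d ^ 2 +
        d * ((n : ℝ) ^ (m + m') * ((m ^ (1 + 1) + m' ^ (1 + 1)) / n ^ 1)) +
        (n : ℝ) ^ (m + m') * ((m ^ (2 + 1) + m' ^ (2 + 1)) / n ^ 2) := by
        gcongr <;> exact sum_sum_overfull_le m m' n _
    _ = _ := by ring

/-- The midpoint rule with step `δ` for the integral of `f` over the product of the simplices of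
size `n * δ`: the simplices are the quotients of the cubes by the permutations. -/
def midpointSum (f : (Fin m → ℝ) × (Fin m' → ℝ) → X) (δ : ℝ) (n : ℕ) : X :=
  (m.factorial * m'.factorial : ℝ)⁻¹ •
    ∑ c : Fin m → Fin n, ∑ c' : Fin m' → Fin n, cellContribution f δ c c'

theorem factorial_smul_setIntegral_simplex_eq_sum (hδ : 0 < δ)
    (hint : IntegrableOn f (simplex m (n * δ) ×ˢ simplex m' (n * δ))) :
    (m.factorial * m'.factorial : ℝ) • ∫ s in simplex m (n * δ) ×ˢ simplex m' (n * δ), f s =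
      ∑ c : Fin m → Fin n, ∑ c' : Fin m' → Fin n,
        ∫ s in box δ c ×ˢ box δ c', symmetrize f s := by
  rw [← setIntegral_symmetrize hint]
  exact setIntegral_prod_eq_sum_of_partition (measurableSet_box δ) (measurableSet_box δ)
    (pairwise_disjoint_box hδ.le) (pairwise_disjoint_box hδ.le) (iUnion_box_ae_eq m n hδ)
    (iUnion_box_ae_eq m' n hδ) fun c c' => (integrableOn_symmetrize hint).mono_set
      (Set.prod_mono (box_subset_cube hδ.le c) (box_subset_cube hδ.le c'))

theorem midpointSum_sub_setIntegral_simplex (hδ : 0 < δ)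
    (hint : IntegrableOn f (simplex m (n * δ) ×ˢ simplex m' (n * δ))) :
    midpointSum f δ n - ∫ s in simplex m (n * δ) ×ˢ simplex m' (n * δ), f s =
      -((m.factorial * m'.factorial : ℝ)⁻¹ • ∑ c : Fin m → Fin n, ∑ c' : Fin m' → Fin n,
        ((∫ s in box δ c ×ˢ box δ c', symmetrize f s) - cellContribution f δ c c')) := by
  have hq : (m.factorial * m'.factorial : ℝ) ≠ 0 := by positivity
  simp only [Finset.sum_sub_distrib]
  rw [← factorial_smul_setIntegral_simplex_eq_sum hδ hint, smul_sub, inv_smul_smul₀ hq, neg_sub,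
    midpointSum]

theorem norm_midpointSum_sub_setIntegral_simplex_le [CompleteSpace X] (hδ : 0 < δ) (hd : 0 ≤ d)
    (hf : HasSecondDiffBound f δ M d)
    (hint : IntegrableOn f (simplex m (n * δ) ×ˢ simplex m' (n * δ))) :
    ‖midpointSum f δ n - ∫ s in simplex m (n * δ) ×ˢ simplex m' (n * δ), f s‖ ≤
      (n * δ) ^ (m + m') / (m.factorial * m'.factorial) * M *
        (d ^ 2 + d * (m ^ 2 + m' ^ 2) / n + (m ^ 3 + m' ^ 3) / n ^ 2) := by
  have hM : 0 ≤ M := hf.nonneg hδ.le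
  have h_box (c : Fin m → Fin n) (c' : Fin m' → Fin n) :
      IntegrableOn (symmetrize f) (box δ c ×ˢ box δ c') :=
    (integrableOn_symmetrize hint).mono_set
      (Set.prod_mono (box_subset_cube hδ.le c) (box_subset_cube hδ.le c'))
  have h_sum : ‖∑ c : Fin m → Fin n, ∑ c' : Fin m' → Fin n,
      ((∫ s in box δ c ×ˢ box δ c', symmetrize f s) - cellContribution f δ c c')‖ ≤
        δ ^ (m + m') * M * ((n : ℝ) ^ (m + m') *
          (d ^ 2 + d * (m ^ 2 + m' ^ 2) / n + (m ^ 3 + m' ^ 3) / n ^ 2)) := by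
    refine (norm_sum_le_of_le _ fun c _ => norm_sum_le_of_le _ fun c' _ =>
      norm_setIntegral_symmetrize_box_sub_cellContribution_le hδ.le hd hf (h_box c c')).trans ?_
    simp only [← Finset.mul_sum]
    gcongr
    exact sum_sum_cell_bound_le m m' n hd
  rw [midpointSum_sub_setIntegral_simplex hδ hint, norm_neg, norm_smul, norm_inv,
    Real.norm_of_nonneg (by positivity)]
  refine (mul_le_mul_of_nonneg_left h_sum (by positivity)).trans_eq ?_
  rw [mul_pow]
  ring

end MidpointSum

/-! ### The terms of the Dyson series -/

section SimplexIntegral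

theorem volume_cube (m : ℕ) (T : ℝ) : volume (cube m T) = ENNReal.ofReal T ^ m := by
  simp [cube, Real.volume_pi_Ioo]

theorem simplex_subset_cube (m : ℕ) (T : ℝ) : simplex m T ⊆ cube m T := fun _ hs _ _ => hs.2 _

theorem volume_cube_prod_lt_top (m m' : ℕ) (T : ℝ) : volume (cube m T ×ˢ cube m' T) < ⊤ := by
  rw [Measure.volume_eq_prod, Measure.prod_prod, volume_cube, volume_cube]
  exact ENNReal.mul_lt_top (ENNReal.pow_lt_top ENNReal.ofReal_lt_top)
    (ENNReal.pow_lt_top ENNReal.ofReal_lt_top)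

theorem volume_real_cube_prod (m m' : ℕ) {T : ℝ} (hT : 0 ≤ T) :
    volume.real (cube m T ×ˢ cube m' T) = T ^ (m + m') := by
  rw [Measure.real, Measure.volume_eq_prod, Measure.prod_prod, volume_cube, volume_cube,
    ENNReal.toReal_mul, ENNReal.toReal_pow, ENNReal.toReal_pow, ENNReal.toReal_ofReal hT, pow_add]

theorem norm_setIntegral_simplex_le {X : Type*} [NormedAddCommGroup X] [NormedSpace ℝ X]
    {m m' : ℕ} {T M : ℝ} (hT : 0 ≤ T) {f : (Fin m → ℝ) × (Fin m' → ℝ) → X}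
    (hint : IntegrableOn f (simplex m T ×ˢ simplex m' T)) (hf : ∀ s, ‖f s‖ ≤ M) :
    ‖∫ s in simplex m T ×ˢ simplex m' T, f s‖ ≤
      T ^ (m + m') / (m.factorial * m'.factorial) * M := by
  have h_cube : ‖∫ s in cube m T ×ˢ cube m' T, symmetrize f s‖ ≤ M * T ^ (m + m') := by
    rw [← volume_real_cube_prod m m' hT]
    exact norm_setIntegral_le_of_norm_le_const (volume_cube_prod_lt_top m m' T) fun s _ => hf _
  rw [setIntegral_symmetrize hint, norm_smul, Real.norm_of_nonneg (by positivity)] at h_cube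
  rw [div_mul_eq_mul_div, le_div_iff₀ (by positivity)]
  linarith

end SimplexIntegral

section Dyson

variable {E : Type*} [NormedAddCommGroup E] [InnerProductSpace ℂ E] [CompleteSpace E]
  {Hs Ws ρ₀ : E →L[ℂ] E} {B : ℝ → ℝ → ℂ} {b b' b'' : ℝ}

theorem integrableOn_kernel (hH : IsSelfAdjoint Hs) (hB : BathBounds B b b' b'') (m m' : ℕ)
    (T : ℝ) :
    IntegrableOn (kernel (m := m) (m' := m') Hs Ws ρ₀ B) (simplex m T ×ˢ simplex m' T) := by
  have h_subset : simplex m T ×ˢ simplex m' T ⊆ cube m T ×ˢ cube m' T :=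
    Set.prod_mono (simplex_subset_cube m T) (simplex_subset_cube m' T)
  have h_cont : ContinuousOn (kernel Hs Ws ρ₀ B) (simplex m T ×ˢ simplex m' T) := fun s hs =>
    (continuousAt_kernel hB (fun i => (hs.1.2 i).1.ne') fun i =>
      (hs.2.2 i).1.ne').continuousWithinAt
  exact IntegrableOn.of_bound
    ((measure_mono h_subset).trans_lt (volume_cube_prod_lt_top m m' T))
    (h_cont.aestronglyMeasurable ((measurableSet_simplex m T).prod (measurableSet_simplex m' T))) _
    (Filter.Eventually.of_forall fun s => norm_kernel_le hH hB s)

theorem dysonIntegrand_eq_mulLeftRight (hH : IsSelfAdjoint Hs) (hW : IsSelfAdjoint Ws) (t : ℝ)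
    (m m' : ℕ) :
    dysonIntegrand Hs Ws ρ₀ B t m m' = fun s => ContinuousLinearMap.mulLeftRight ℝ (E →L[ℂ] E)
      (freeProp Hs t) (freeProp Hs (-t)) (kernel Hs Ws ρ₀ B s) := by
  funext s
  rw [dysonIntegrand_eq hH hW, ContinuousLinearMap.mulLeftRight_apply]

theorem integrableOn_dysonIntegrand (hH : IsSelfAdjoint Hs) (hW : IsSelfAdjoint Ws)
    (hB : BathBounds B b b' b'') (m m' : ℕ) (t : ℝ) :
    IntegrableOn (dysonIntegrand Hs Ws ρ₀ B t m m') (simplex m t ×ˢ simplex m' t) := by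
  rw [dysonIntegrand_eq_mulLeftRight hH hW]
  exact ContinuousLinearMap.integrable_comp _ (integrableOn_kernel hH hB m m' t)

theorem dysonTerm_eq (hH : IsSelfAdjoint Hs) (hW : IsSelfAdjoint Ws) (hB : BathBounds B b b' b'')
    (t : ℝ) (p : ℕ × ℕ) :
    dysonTerm Hs Ws ρ₀ B t p = freeProp Hs t *
      (∫ s in simplex p.1 t ×ˢ simplex p.2 t, kernel Hs Ws ρ₀ B s) * freeProp Hs (-t) := by
  rw [dysonTerm, dysonIntegrand_eq_mulLeftRight hH hW,
    ContinuousLinearMap.integral_comp_comm _ (integrableOn_kernel hH hB p.1 p.2 t),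
    ContinuousLinearMap.mulLeftRight_apply]

end Dyson

/-! ### The scheme in the interaction picture -/

section Lists

variable {m m' n : ℕ}

theorem bathInfluence_cast (B : ℝ → ℝ → ℂ) {N N' : ℕ} (h : N = N') (x : Fin N' → ℝ) :
    bathInfluence B (fun i => x (Fin.cast h i)) = bathInfluence B x := by
  subst h; rfl

theorem bathInfluence_get_ofFn (B : ℝ → ℝ → ℂ) {N : ℕ} (x : Fin N → ℝ) :
    bathInfluence B (List.ofFn x).get = bathInfluence B x := by
  rw [← bathInfluence_cast B (List.length_ofFn (f := x)) x]
  exact congrArg _ (funext fun i => List.get_ofFn x i)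

theorem ofFn_comp_rev {α : Type*} (s : Fin m → α) :
    List.ofFn (fun i => s (Fin.rev i)) = (List.ofFn s).reverse := by
  refine List.ext_getElem (by simp) fun k hk _ => ?_
  simp only [List.length_ofFn] at hk
  simp only [List.getElem_ofFn, List.getElem_reverse, List.length_ofFn]
  exact congrArg s (Fin.ext (by simp only [Fin.val_rev]; omega))

theorem ofFn_signedTimes (s : (Fin m → ℝ) × (Fin m' → ℝ)) :
    List.ofFn (signedTimes s) = (List.ofFn s.1).reverse.map (-·) ++ List.ofFn s.2 := by
  rw [signedTimes, List.ofFn_fin_append, ← ofFn_comp_rev, List.map_ofFn]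
  rfl

theorem prod_map_star {A : Type*} [Monoid A] [StarMul A] (l : List A) :
    (l.map star).prod = star l.reverse.prod := by
  induction l with
  | nil => simp
  | cons a l ih => simp [ih]

/-- The increasing list in which the midpoint of the `k`-th time step occurs `j k` times. -/
def midList (δ : ℝ) (j : Fin n → ℕ) : List ℝ :=
  (List.ofFn fun k : Fin n => List.replicate (j k) (((k : ℕ) + 1 / 2) * δ)).flatten

theorem midList_succ (δ : ℝ) (j : Fin (n + 1) → ℕ) :
    midList δ j = midList δ (fun k => j k.castSucc) ++
      List.replicate (j (Fin.last n)) ((n + 1 / 2) * δ) := by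
  simp only [midList, List.ofFn_succ', List.concat_eq_append, List.flatten_append,
    List.flatten_singleton, Fin.val_castSucc, Fin.val_last]

theorem length_midList (δ : ℝ) (j : Fin n → ℕ) : (midList δ j).length = ∑ k, j k := by
  simp [midList, List.length_flatten, List.map_ofFn, List.sum_ofFn, Function.comp_def]

theorem midList_occupation (δ : ℝ) (c : Fin m → Fin n) :
    midList δ (occupation c) = List.ofFn (cellMid δ (c ∘ Tuple.sort c)) := by
  have h_map : midList δ (occupation c) =
      (occupationList (occupation c)).map fun k : Fin n => ((k : ℕ) + 1 / 2) * δ := by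
    simp [midList, occupationList, List.map_flatten, List.map_ofFn, Function.comp_def]
  rw [h_map, occupationList_occupation, List.map_ofFn]
  rfl

theorem midpoints_eq (δ : ℝ) (jm jp : Fin n → Fin 3) :
    midpoints δ jm jp = (midList δ fun k => (jm k : ℕ)).reverse.map (-·) ++
      midList δ fun k => (jp k : ℕ) := by
  simp only [midpoints, midList, neg_mul, List.reverse_flatten, List.map_flatten, List.map_ofFn,
    List.map_reverse, Function.comp_def, List.reverse_replicate, List.map_replicate]

end Lists

section Scheme

variable {E : Type*} [NormedAddCommGroup E] [InnerProductSpace ℂ E] [CompleteSpace E]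

/-- The integrand `kernel` as a function of the lists of times on the two branches. -/
def listKernel (Hs Ws ρ₀ : E →L[ℂ] E) (B : ℝ → ℝ → ℂ) (l l' : List ℝ) : E →L[ℂ] E :=
  ((-Complex.I) ^ l.length * Complex.I ^ l'.length *
      bathInfluence B (l.reverse.map (-·) ++ l').get) •
    ((l.map (interaction Hs Ws)).reverse.prod * ρ₀ *
      star (l'.map (interaction Hs Ws)).reverse.prod)

theorem listKernel_ofFn (Hs Ws ρ₀ : E →L[ℂ] E) (B : ℝ → ℝ → ℂ) {m m' : ℕ}
    (s : (Fin m → ℝ) × (Fin m' → ℝ)) :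
    listKernel Hs Ws ρ₀ B (List.ofFn s.1) (List.ofFn s.2) = kernel Hs Ws ρ₀ B s := by
  rw [listKernel, ← ofFn_signedTimes, bathInfluence_get_ofFn, kernel]
  simp only [List.length_ofFn, List.map_ofFn, interactionProd]
  rfl

theorem stepOp_eq (Hs Ws : E →L[ℂ] E) (δ a : ℝ) (j : Fin 3) :
    stepOp Hs Ws δ j = ((-Complex.I) ^ (j : ℕ) * ((δ ^ (j : ℕ) / (j : ℕ).factorial : ℝ) : ℂ)) •
      (freeProp Hs ((a + 1) * δ) * interaction Hs Ws ((a + 1 / 2) * δ) ^ (j : ℕ) *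
        freeProp Hs (-(a * δ))) := by
  set μ := (a + 1 / 2) * δ with hμ
  have h_end : freeProp Hs ((a + 1) * δ) * freeProp Hs (-μ) = freeProp Hs (δ / 2) := by
    rw [← freeProp_add, hμ]; congr 1; ring
  have h_start : freeProp Hs μ * freeProp Hs (-(a * δ)) = freeProp Hs (δ / 2) := by
    rw [← freeProp_add, hμ]; congr 1; ring
  have h_step : freeProp Hs ((a + 1) * δ) * freeProp Hs (-(a * δ)) = freeProp Hs δ := by
    rw [← freeProp_add]; congr 1; ring
  have h_cancel := freeProp_mul_freeProp_neg Hs μ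
  clear_value μ
  fin_cases j
  · simp [stepOp, h_step]
  · have h_assoc : freeProp Hs ((a + 1) * δ) * interaction Hs Ws μ * freeProp Hs (-(a * δ)) =
        (freeProp Hs ((a + 1) * δ) * freeProp Hs (-μ)) * Ws *
          (freeProp Hs μ * freeProp Hs (-(a * δ))) := by
      simp only [interaction, mul_assoc]
    simp [stepOp, h_assoc, h_end, h_start]
  · have h_assoc : freeProp Hs ((a + 1) * δ) * (interaction Hs Ws μ * interaction Hs Ws μ) *
        freeProp Hs (-(a * δ)) = (freeProp Hs ((a + 1) * δ) * freeProp Hs (-μ)) *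
          (Ws * (freeProp Hs μ * freeProp Hs (-μ)) * Ws) *
          (freeProp Hs μ * freeProp Hs (-(a * δ))) := by
      simp only [interaction, mul_assoc]
    simp [stepOp, h_assoc, h_end, h_start, h_cancel, pow_two]

/-- The factor `∏ δ ^ j_k / j_k!` that the steps of the scheme with occupation numbers `j`
contribute. -/
def weight {n : ℕ} (δ : ℝ) (j : Fin n → ℕ) : ℝ := ∏ k, δ ^ j k / (j k).factorial

theorem stepOp_prod_eq (Hs Ws : E →L[ℂ] E) (δ : ℝ) {n : ℕ} (j : Fin n → Fin 3) :
    (List.ofFn fun k => stepOp Hs Ws δ (j k)).reverse.prod =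
      ((-Complex.I) ^ (∑ k, (j k : ℕ)) * ((weight δ fun k => (j k : ℕ) : ℝ) : ℂ)) •
        (freeProp Hs (n * δ) *
          ((midList δ fun k => (j k : ℕ)).map (interaction Hs Ws)).reverse.prod) := by
  induction n with
  | zero => simp [weight, midList, freeProp_zero]
  | succ n ih =>
    have h_cancel : freeProp Hs (-(n * δ)) * freeProp Hs (n * δ) = 1 := by
      simpa only [neg_neg] using freeProp_mul_freeProp_neg Hs (-(n * δ))
    simp only [List.ofFn_succ', List.concat_eq_append, List.reverse_append, List.reverse_singleton,
      List.singleton_append, List.prod_cons]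
    rw [ih, stepOp_eq Hs Ws δ n, midList_succ, weight, weight, Fin.sum_univ_castSucc,
      Fin.prod_univ_castSucc, List.map_append, List.reverse_append, List.prod_append,
      List.map_replicate, List.reverse_replicate, List.prod_replicate, smul_mul_smul_comm]
    congr 1
    · push_cast
      ring
    · push_cast
      rw [mul_assoc _ (freeProp Hs (-(n * δ))), ← mul_assoc (freeProp Hs (-(n * δ))), h_cancel,
        one_mul, mul_assoc]

theorem secondOrderScheme_eq_sum_weight {Hs : E →L[ℂ] E} (hH : IsSelfAdjoint Hs)
    (Ws ρ₀ : E →L[ℂ] E) (B : ℝ → ℝ → ℂ) (δ : ℝ) (n : ℕ) :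
    secondOrderScheme Hs Ws ρ₀ B δ n = freeProp Hs (n * δ) *
      (∑ jm : Fin n → Fin 3, ∑ jp : Fin n → Fin 3,
        weight δ (fun k => (jm k : ℕ)) • weight δ (fun k => (jp k : ℕ)) •
          listKernel Hs Ws ρ₀ B (midList δ fun k => (jm k : ℕ)) (midList δ fun k => (jp k : ℕ))) *
      freeProp Hs (-(n * δ)) := by
  simp only [secondOrderScheme, Finset.mul_sum, Finset.sum_mul]
  refine Finset.sum_congr rfl fun jm _ => Finset.sum_congr rfl fun jp _ => ?_
  have h_star : (List.ofFn fun k => star (stepOp Hs Ws δ (jp k))).prod =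
      star (List.ofFn fun k => stepOp Hs Ws δ (jp k)).reverse.prod := by
    rw [← prod_map_star, List.map_ofFn]
    rfl
  have h_conj (k : ℕ) (r : ℝ) : star ((-Complex.I) ^ k * (r : ℂ)) = Complex.I ^ k * r := by simp
  rw [h_star, stepOp_prod_eq, stepOp_prod_eq, listKernel, midpoints_eq, length_midList,
    length_midList, star_smul, h_conj, star_mul, star_freeProp hH]
  simp only [← Complex.coe_smul, smul_mul_assoc, mul_smul_comm, smul_smul, mul_assoc]
  congr 1
  ring

end Scheme

/-! ### The scheme as a midpoint rule -/

section Regroup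

variable {n : ℕ}

theorem le_mul_of_atMost {m r : ℕ} {c : Fin m → Fin n} (h : AtMost r c) : m ≤ r * n :=
  calc m = ∑ k, occupation c k := by rw [sum_occupation, Fintype.card_fin]
    _ ≤ ∑ _k : Fin n, r := Finset.sum_le_sum fun k _ => h k
    _ = r * n := by simp [mul_comm]

theorem weight_eq_multinomial_mul (δ : ℝ) (j : Fin n → ℕ) :
    weight δ j =
      Nat.multinomial Finset.univ j * (δ ^ (∑ k, j k) / (∑ k, j k).factorial) := by
  have h_prod : (∏ k, ((j k).factorial : ℝ)) ≠ 0 :=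
    Finset.prod_ne_zero_iff.2 fun k _ => by positivity
  have h_multinomial : (Nat.multinomial Finset.univ j : ℝ) ≠ 0 :=
    Nat.cast_ne_zero.2 (Nat.multinomial_pos Finset.univ j).ne'
  rw [weight, Finset.prod_div_distrib, Finset.prod_pow_eq_pow_sum,
    ← Nat.multinomial_spec Finset.univ j]
  push_cast
  field_simp

theorem sum_fin_eq_sum_piAntidiag {Y : Type*} [AddCommMonoid Y] (r : ℕ) (g : (Fin n → ℕ) → Y)
    (m : ℕ) :
    ∑ j : Fin n → Fin (r + 1) with ∑ k, (j k : ℕ) = m, g (fun k => (j k : ℕ)) =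
      ∑ j ∈ Finset.piAntidiag Finset.univ m, if ∀ k, j k ≤ r then g j else 0 := by
  rw [← Finset.sum_filter]
  refine Finset.sum_bij (fun j _ k => (j k : ℕ)) (fun j hj => ?_) (fun j _ j' _ h => ?_)
    (fun j hj => ?_) fun _ _ => rfl
  · simp only [Finset.mem_filter, Finset.mem_univ, true_and] at hj
    simp only [Finset.mem_filter, Finset.mem_piAntidiag, Finset.mem_univ, implies_true, and_true]
    exact ⟨hj, fun k => Nat.lt_succ_iff.1 (j k).2⟩
  · exact funext fun k => Fin.ext (congrFun h k)
  · simp only [Finset.mem_filter, Finset.mem_piAntidiag, Finset.mem_univ, implies_true,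
      and_true] at hj
    exact ⟨fun k => ⟨j k, Nat.lt_succ_iff.2 (hj.2 k)⟩, by simpa using hj.1, rfl⟩

theorem sum_weight_smul_eq {X : Type*} [AddCommGroup X] [Module ℝ X] (r : ℕ) (δ : ℝ)
    (φ : (Fin n → ℕ) → X) :
    ∑ j : Fin n → Fin (r + 1), weight δ (fun k => (j k : ℕ)) • φ (fun k => (j k : ℕ)) =
      ∑ m ∈ Finset.range (r * n + 1), ∑ c : Fin m → Fin n,
        if AtMost r c then (δ ^ m / m.factorial) • φ (occupation c) else 0 := by
  have h_range (j : Fin n → Fin (r + 1)) : ∑ k, (j k : ℕ) ∈ Finset.range (r * n + 1) := by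
    rw [Finset.mem_range, Nat.lt_succ_iff]
    calc ∑ k, (j k : ℕ) ≤ ∑ _k : Fin n, r := Finset.sum_le_sum fun k _ => by omega
      _ = r * n := by simp [mul_comm]
  rw [← Finset.sum_fiberwise_of_maps_to fun j _ => h_range j]
  refine Finset.sum_congr rfl fun m _ => ?_
  have h_multinomial := sum_occupation_eq_sum_multinomial (ι := Fin m)
    fun j : Fin n → ℕ => if ∀ k, j k ≤ r then (δ ^ m / m.factorial) • φ j else 0
  rw [sum_fin_eq_sum_piAntidiag r (fun j => weight δ j • φ j) m, h_multinomial, Fintype.card_fin]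
  refine Finset.sum_congr rfl fun j hj => ?_
  have h_sum : ∑ k, j k = m := by simpa using hj
  rw [smul_ite, smul_zero, ← Nat.cast_smul_eq_nsmul ℝ, smul_smul, weight_eq_multinomial_mul, h_sum]

end Regroup

section MidpointScheme

theorem midpointSum_eq_zero {X : Type*} [NormedAddCommGroup X] [NormedSpace ℝ X] {m m' n : ℕ}
    (f : (Fin m → ℝ) × (Fin m' → ℝ) → X) (δ : ℝ) (h : ¬(m ≤ 2 * n ∧ m' ≤ 2 * n)) :
    midpointSum f δ n = 0 := by
  rw [midpointSum, Finset.sum_eq_zero, smul_zero]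
  exact fun c _ => Finset.sum_eq_zero fun c' _ =>
    if_neg fun hc => h ⟨le_mul_of_atMost hc.1, le_mul_of_atMost hc.2⟩

variable {E : Type*} [NormedAddCommGroup E] [InnerProductSpace ℂ E] [CompleteSpace E]

theorem midpointSum_kernel (Hs Ws ρ₀ : E →L[ℂ] E) (B : ℝ → ℝ → ℂ) (δ : ℝ) (m m' n : ℕ) :
    midpointSum (kernel (m := m) (m' := m') Hs Ws ρ₀ B) δ n =
      ∑ c : Fin m → Fin n, ∑ c' : Fin m' → Fin n,
        if AtMost 2 c then (δ ^ m / m.factorial) •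
          (if AtMost 2 c' then (δ ^ m' / m'.factorial) •
            listKernel Hs Ws ρ₀ B (midList δ (occupation c)) (midList δ (occupation c'))
          else 0) else 0 := by
  simp only [midpointSum, Finset.smul_sum]
  refine Finset.sum_congr rfl fun c _ => Finset.sum_congr rfl fun c' _ => ?_
  simp only [cellContribution, ite_and, smul_ite, smul_zero, smul_smul, midList_occupation]
  rw [listKernel_ofFn Hs Ws ρ₀ B (cellMid δ (c ∘ Tuple.sort c), cellMid δ (c' ∘ Tuple.sort c')),
    cellValue, ← div_eq_inv_mul, pow_add, mul_div_mul_comm]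

theorem secondOrderScheme_eq_sum_midpointSum {Hs : E →L[ℂ] E} (hH : IsSelfAdjoint Hs)
    (Ws ρ₀ : E →L[ℂ] E) (B : ℝ → ℝ → ℂ) (δ : ℝ) (n : ℕ) :
    secondOrderScheme Hs Ws ρ₀ B δ n = freeProp Hs (n * δ) *
      (∑ p ∈ Finset.range (2 * n + 1) ×ˢ Finset.range (2 * n + 1),
        midpointSum (kernel (m := p.1) (m' := p.2) Hs Ws ρ₀ B) δ n) *
          freeProp Hs (-(n * δ)) := by
  rw [secondOrderScheme_eq_sum_weight hH]
  congr 2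
  simp only [← Finset.smul_sum]
  rw [sum_weight_smul_eq 2 δ fun j => ∑ jp : Fin n → Fin 3, weight δ (fun k => (jp k : ℕ)) •
    listKernel Hs Ws ρ₀ B (midList δ j) (midList δ fun k => (jp k : ℕ)), Finset.sum_product]
  refine Finset.sum_congr rfl fun m _ => ?_
  simp only [midpointSum_kernel]
  rw [Finset.sum_comm]
  refine Finset.sum_congr rfl fun c _ => ?_
  rw [sum_weight_smul_eq 2 δ fun j =>
    listKernel Hs Ws ρ₀ B (midList δ (occupation c)) (midList δ j)]
  split_ifs with h
  · simp only [Finset.smul_sum]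
  · simp only [Finset.sum_const_zero]

end MidpointScheme

/-! ### Summation of the error -/

section Majorant

/-- Up to constant factors, `majorant x (m, m')` bounds the term of order `(m, m')` of the Dyson
series and its discretization error: the factorials are the inverse volume of the simplices, and
the number of pairings comes from the bath influence functional. -/
def majorant (x : ℝ) (p : ℕ × ℕ) : ℝ :=
  (pairings (p.1 + p.2)).card * x ^ (p.1 + p.2) / (p.1.factorial * p.2.factorial)

theorem majorant_nonneg {x : ℝ} (hx : 0 ≤ x) (p : ℕ × ℕ) : 0 ≤ majorant x p := by
  unfold majorant
  positivity

theorem two_mul_le_mul_sq_add_one_div {c : ℝ} (hc : 0 < c) (u : ℝ) :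
    2 * u ≤ c * u ^ 2 + 1 / c := by
  have h_square : c * u ^ 2 + 1 / c - 2 * u = c * (u - 1 / c) ^ 2 := by
    field_simp
    ring
  rw [← sub_nonneg, h_square]
  positivity

theorem summable_pow_div_sqrt_factorial {x : ℝ} (hx : 0 ≤ x) :
    Summable fun m : ℕ => x ^ m / √(m.factorial : ℝ) := by
  have h_sum : Summable fun m : ℕ => (2 * x ^ 2) ^ m / (m.factorial : ℝ) + (1 / 2 : ℝ) ^ m :=
    (Real.summable_pow_div_factorial _).add summable_geometric_two
  refine h_sum.of_nonneg_of_le (fun m => by positivity) fun m => ?_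
  have h_sq : (x ^ m / √(m.factorial : ℝ)) ^ 2 = (x ^ 2) ^ m / m.factorial := by
    rw [div_pow, Real.sq_sqrt (by positivity), ← pow_mul, ← pow_mul, mul_comm m 2]
  have h_nonneg : 0 ≤ x ^ m / √(m.factorial : ℝ) := by positivity
  calc x ^ m / √(m.factorial : ℝ) ≤ 2 * (x ^ m / √(m.factorial : ℝ)) := by linarith
    _ ≤ 2 ^ m * (x ^ m / √(m.factorial : ℝ)) ^ 2 + 1 / 2 ^ m :=
      two_mul_le_mul_sq_add_one_div (by positivity) _
    _ = (2 * x ^ 2) ^ m / (m.factorial : ℝ) + (1 / 2 : ℝ) ^ m := by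
      rw [h_sq, mul_pow, mul_div_assoc, div_pow, one_pow]

theorem card_pairings_add_le (m m' : ℕ) :
    ((pairings (m + m')).card : ℝ) ≤
      √2 ^ (m + m') * (√(m.factorial : ℝ) * √(m'.factorial : ℝ)) := by
  have h_factorial : (m + m').factorial ≤ 2 ^ (m + m') * (m.factorial * m'.factorial) := by
    rw [← Nat.add_choose_mul_factorial_mul_factorial, mul_assoc]
    gcongr
    exact Nat.choose_le_two_pow _ _
  refine le_of_sq_le_sq ?_ (by positivity)
  rw [mul_pow, mul_pow, pow_right_comm, Real.sq_sqrt zero_le_two, Real.sq_sqrt (by positivity),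
    Real.sq_sqrt (by positivity)]
  exact_mod_cast (card_pairings_sq_le (m + m')).trans h_factorial

theorem summable_majorant {x : ℝ} (hx : 0 ≤ x) : Summable (majorant x) := by
  have h_single := summable_pow_div_sqrt_factorial (x := √2 * x) (by positivity)
  refine (h_single.mul_of_nonneg h_single (fun m => by positivity)
    fun m => by positivity).of_nonneg_of_le (majorant_nonneg hx) ?_
  rintro ⟨m, m'⟩
  have h_split (k : ℕ) : (k.factorial : ℝ) = √(k.factorial : ℝ) * √(k.factorial : ℝ) :=
    (Real.mul_self_sqrt (by positivity)).symm
  calc majorant x (m, m')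
      ≤ √2 ^ (m + m') * (√(m.factorial : ℝ) * √(m'.factorial : ℝ)) * x ^ (m + m') /
        (m.factorial * m'.factorial) := by
        unfold majorant
        gcongr
        exact card_pairings_add_le m m'
    _ = (√2 * x) ^ m / √(m.factorial : ℝ) * ((√2 * x) ^ m' / √(m'.factorial : ℝ)) := by
        rw [h_split m, h_split m']
        simp only [Real.sqrt_mul_self (Real.sqrt_nonneg _)]
        field_simp
        ring

end Majorant

section ErrorFactor

theorem natCast_cube_le_eight_pow (N : ℕ) : (N : ℝ) ^ 3 ≤ 8 ^ N := by
  have h_lt : (N : ℝ) ≤ 2 ^ N := by exact_mod_cast Nat.lt_two_pow_self.le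
  calc (N : ℝ) ^ 3 ≤ (2 ^ N) ^ 3 := by gcongr
    _ = 8 ^ N := by rw [pow_right_comm]; norm_num

theorem natCast_sq_le_eight_pow (N : ℕ) : (N : ℝ) ^ 2 ≤ 8 ^ N := by
  have h_lt : (N : ℝ) ≤ 2 ^ N := by exact_mod_cast Nat.lt_two_pow_self.le
  calc (N : ℝ) ^ 2 ≤ (2 ^ N) ^ 2 := by gcongr
    _ = 4 ^ N := by rw [pow_right_comm]; norm_num
    _ ≤ 8 ^ N := by gcongr; norm_num

theorem quadrature_factor_le (m m' n : ℕ) {α δ : ℝ} (hα : 0 ≤ α) (hδ : 0 < δ) :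
    ((m + m' : ℕ) * (α * δ)) ^ 2 + (m + m' : ℕ) * (α * δ) * (m ^ 2 + m' ^ 2) / n +
      (m ^ 3 + m' ^ 3) / n ^ 2 ≤
      8 ^ (m + m') * (α ^ 2 + α * (n * δ)⁻¹ + (n * δ)⁻¹ ^ 2) * δ ^ 2 := by
  have h_sq : ((m : ℝ) + m') ^ 2 ≤ 8 ^ (m + m') := by
    exact_mod_cast natCast_sq_le_eight_pow (m + m')
  have h_cube : ((m : ℝ) + m') ^ 3 ≤ 8 ^ (m + m') := by
    exact_mod_cast natCast_cube_le_eight_pow (m + m')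
  have h_cross : (0 : ℝ) ≤ m * m' * (m + m') := by positivity
  have h_mixed : ((m : ℝ) + m') * (m ^ 2 + m' ^ 2) ≤ 8 ^ (m + m') := by linarith
  have h_cubes : (m : ℝ) ^ 3 + m' ^ 3 ≤ 8 ^ (m + m') := by linarith
  calc _ = (((m : ℝ) + m') ^ 2 * α ^ 2 + ((m : ℝ) + m') * (m ^ 2 + m' ^ 2) * (α * (n * δ)⁻¹) +
        (m ^ 3 + m' ^ 3) * (n * δ)⁻¹ ^ 2) * δ ^ 2 := by
        push_cast
        field_simp
    _ ≤ (8 ^ (m + m') * α ^ 2 + 8 ^ (m + m') * (α * (n * δ)⁻¹) +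
        8 ^ (m + m') * (n * δ)⁻¹ ^ 2) * δ ^ 2 := by gcongr
    _ = _ := by ring

end ErrorFactor

section Convergence

/-- The constant of the error bound, with `r`, `w`, `h` standing for the norms of `ρ₀`, `Ws`,
`Hs`. The factor `8` of the majorant absorbs the powers of the order `m + m'` in the error of the
midpoint rule. -/
def errorConst (r w h b b' b'' T : ℝ) : ℝ :=
  r * ((1 + 2 * b' + 6 * b'' + 4 * h) ^ 2 + (1 + 2 * b' + 6 * b'' + 4 * h) * T⁻¹ + T⁻¹ ^ 2) *
    ∑' p, majorant (8 * (T * ((1 + b) * w))) p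

variable {E : Type*} [NormedAddCommGroup E] [InnerProductSpace ℂ E] [CompleteSpace E]
  {Hs Ws ρ₀ : E →L[ℂ] E} {B : ℝ → ℝ → ℂ} {b b' b'' : ℝ}

theorem norm_dysonTerm_le (hH : IsSelfAdjoint Hs) (hW : IsSelfAdjoint Ws)
    (hB : BathBounds B b b' b'') {T : ℝ} (hT : 0 ≤ T) (p : ℕ × ℕ) :
    ‖dysonTerm Hs Ws ρ₀ B T p‖ ≤ ‖ρ₀‖ * majorant (T * ((1 + b) * ‖Ws‖)) p := by
  rw [dysonTerm_eq hH hW hB]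
  calc _ ≤ _ := norm_freeProp_mul_mul_freeProp_le hH _ _ _
    _ ≤ _ := norm_setIntegral_simplex_le hT (integrableOn_kernel hH hB p.1 p.2 T)
      (norm_kernel_le hH hB)
    _ = _ := by
      rw [majorant, mul_pow T]
      ring

theorem summable_dysonTerm (hH : IsSelfAdjoint Hs) (hW : IsSelfAdjoint Ws)
    (hB : BathBounds B b b' b'') {T : ℝ} (hT : 0 ≤ T) : Summable (dysonTerm Hs Ws ρ₀ B T) := by
  have hb := hB.nonneg
  exact Summable.of_norm_bounded ((summable_majorant (by positivity)).mul_left _)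
    (norm_dysonTerm_le hH hW hB hT)

theorem norm_midpointSum_kernel_sub_le (hH : IsSelfAdjoint Hs) (hB : BathBounds B b b' b'')
    {n : ℕ} {δ α : ℝ} (hδ : 0 < δ) (hα : α = 1 + 2 * b' + 6 * b'' + 4 * ‖Hs‖) (p : ℕ × ℕ) :
    ‖midpointSum (kernel (m := p.1) (m' := p.2) Hs Ws ρ₀ B) δ n -
        ∫ s in simplex p.1 (n * δ) ×ˢ simplex p.2 (n * δ), kernel Hs Ws ρ₀ B s‖ ≤
      ‖ρ₀‖ * (α ^ 2 + α * (n * δ)⁻¹ + (n * δ)⁻¹ ^ 2) * δ ^ 2 *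
        majorant (8 * (n * δ * ((1 + b) * ‖Ws‖))) p := by
  obtain ⟨m, m'⟩ := p
  have hb := hB.nonneg
  have hb' := hB.nonneg'
  have hb'' := hB.nonneg''
  have hα_nonneg : 0 ≤ α := by
    rw [hα]
    positivity
  calc _ ≤ (n * δ) ^ (m + m') / (m.factorial * m'.factorial) *
        ((pairings (m + m')).card * (‖ρ₀‖ * ((1 + b) * ‖Ws‖) ^ (m + m'))) *
        (((m + m' : ℕ) * (α * δ)) ^ 2 + (m + m' : ℕ) * (α * δ) * (m ^ 2 + m' ^ 2) / n +
          (m ^ 3 + m' ^ 3) / n ^ 2) :=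
        norm_midpointSum_sub_setIntegral_simplex_le hδ (by positivity)
          (hα ▸ hasSecondDiffBound_kernel hH hB hδ.le) (integrableOn_kernel hH hB m m' _)
    _ ≤ (n * δ) ^ (m + m') / (m.factorial * m'.factorial) *
        ((pairings (m + m')).card * (‖ρ₀‖ * ((1 + b) * ‖Ws‖) ^ (m + m'))) *
        (8 ^ (m + m') * (α ^ 2 + α * (n * δ)⁻¹ + (n * δ)⁻¹ ^ 2) * δ ^ 2) :=
        mul_le_mul_of_nonneg_left (quadrature_factor_le m m' n hα_nonneg hδ) (by positivity)
    _ = _ := by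
        rw [majorant, mul_pow 8, mul_pow (n * δ)]
        ring

theorem hasSum_midpointSum_kernel (hH : IsSelfAdjoint Hs) (δ : ℝ) (n : ℕ) :
    HasSum (fun p : ℕ × ℕ => freeProp Hs (n * δ) *
      midpointSum (kernel (m := p.1) (m' := p.2) Hs Ws ρ₀ B) δ n * freeProp Hs (-(n * δ)))
      (secondOrderScheme Hs Ws ρ₀ B δ n) := by
  rw [secondOrderScheme_eq_sum_midpointSum hH]
  refine ((hasSum_sum_of_ne_finset_zero fun p hp => midpointSum_eq_zero _ δ ?_).mul_left
    _).mul_right _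
  simpa only [Finset.mem_product, Finset.mem_range, Nat.lt_succ_iff] using hp

theorem norm_secondOrderScheme_sub_le (hH : IsSelfAdjoint Hs) (hW : IsSelfAdjoint Ws)
    (hB : BathBounds B b b' b'') {n : ℕ} {δ : ℝ} (hδ : 0 < δ) :
    ‖secondOrderScheme Hs Ws ρ₀ B δ n - reducedDensity Hs Ws ρ₀ B (n * δ)‖ ≤
      errorConst ‖ρ₀‖ ‖Ws‖ ‖Hs‖ b b' b'' (n * δ) * δ ^ 2 := by
  have hb := hB.nonneg
  have h_dyson := (summable_dysonTerm (ρ₀ := ρ₀) hH hW hB (T := n * δ) (by positivity)).hasSum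
  have h_majorant : Summable (majorant (8 * (n * δ * ((1 + b) * ‖Ws‖)))) :=
    summable_majorant (by positivity)
  rw [errorConst, mul_right_comm]
  refine ((hasSum_midpointSum_kernel hH δ n).sub h_dyson).norm_le_of_bounded
    (h_majorant.hasSum.mul_left _) fun p => ?_
  rw [dysonTerm_eq hH hW hB, ← sub_mul, ← mul_sub]
  exact (norm_freeProp_mul_mul_freeProp_le hH _ _ _).trans
    (norm_midpointSum_kernel_sub_le hH hB hδ rfl p)

end Convergence

end OpenSystem

end

theorem mainTheorem3 (r w h b b' b'' T : ℝ) :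
    ∃ C : ℝ, ∀ (E : Type*) [NormedAddCommGroup E] [InnerProductSpace ℂ E] [CompleteSpace E]
      (Hs Ws ρ₀ : E →L[ℂ] E) (B : ℝ → ℝ → ℂ),
      IsSelfAdjoint Hs → IsSelfAdjoint Ws →
      ‖ρ₀‖ = r → ‖Ws‖ = w → ‖Hs‖ = h → OpenSystem.BathBounds B b b' b'' →
      ∀ (n : ℕ) (δ : ℝ), 0 < δ → n * δ = T →
        (∀ m m' : ℕ, MeasureTheory.IntegrableOn
            (OpenSystem.dysonIntegrand Hs Ws ρ₀ B (n * δ) m m')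
            (OpenSystem.simplex m (n * δ) ×ˢ OpenSystem.simplex m' (n * δ))) ∧
        Summable (OpenSystem.dysonTerm Hs Ws ρ₀ B (n * δ)) ∧
        ‖OpenSystem.secondOrderScheme Hs Ws ρ₀ B δ n -
            OpenSystem.reducedDensity Hs Ws ρ₀ B (n * δ)‖ ≤ C * δ ^ 2 := by
  refine ⟨OpenSystem.errorConst r w h b b' b'' T, ?_⟩
  rintro E _ _ _ Hs Ws ρ₀ B hH hW rfl rfl rfl hB n δ hδ rfl
  exact ⟨fun m m' => OpenSystem.integrableOn_dysonIntegrand hH hW hB m m' _,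
    OpenSystem.summable_dysonTerm hH hW hB (by positivity),
    OpenSystem.norm_secondOrderScheme_sub_le hH hW hB hδ⟩
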